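/- Let $G$ be a graph on a finite vertex set $V$, $|V|=p$, with a clique forest: a finite family $\mathcal C$ of cliques of $G$ arranged as the nodes of a forest, such that two distinct vertices are adjacent in $G$ iff they lie in a common clique of $\mathcal C$, and such that for every vertex the cliques containing it form a nonempty connected subgraph of the forest. Let $\mathcal S$ be the family of separators $c\cap c'$, one for each edge $\{c,c'\}$ of the forest (so counted with multiplicity). Let $\Theta$ be the set of pairs $(\mu,J)$ with $\mu\in\mathbb R^V$ and $J$ a symmetric positive definite $V\times V$ matrix with $J_{ij}=0$ whenever $i\ne j$ are not adjacent in $G$. Let $\nu>2$, let $x(1),\dots,x(q)\in\mathbb R^V$ with $q\ge1$, and for $(\mu,J)\in\Theta$ put $d^2_s=(x(s)-\mu)^{\mathsf T}J(x(s)-\mu)$. The Student-t log-likelihood with inverse covariance $J$ is $$\ell(\mu,J)=q\log\frac{\Gamma(\frac{\nu+p}2)}{((\nu-2)\pi)^{p/2}\,\Gamma(\frac\nu2)}+\frac q2\log|J|-\frac{\nu+p}2\sum_{s=1}^q\log\Bigl(1+\frac{d_s^2}{\nu-2}\Bigr).$$ For $\theta=(\mu,J)\in\Theta$ let $f(y,z\mid\theta)$,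 $z>0$, be the density of the Gamma distribution (shape $\frac\nu2$, rate $\frac\nu2$) at $z$ times the normal density at $y$ with mean $\mu$ and inverse covariance $\frac{\nu}{\nu-2}zJ$; let $f(z\mid y,\theta)=f(y,z\mid\theta)/\int_0^\infty f(y,u\mid\theta)\,du$, and let $Q(\eta\mid\theta)=\sum_s\int_0^\infty f(z\mid x(s),\theta)\log f(x(s),z\mid\eta)\,dz$ for $\eta\in\Theta$. An EM update of $\theta=(\mu,J)\in\Theta$ is either a maximizer $\theta'\in\Theta$ of $Q(\cdot\mid\theta)$ (joint update), or a $\theta'=(\mu',J')\in\Theta$ such that $\mu'$ maximizes $Q((\cdot,J')\mid\theta)$ and $J'$ maximizes $Q((\mu,\cdot)\mid\theta)$ over the admissible matrices (separate update). An EM sequence is a sequence in $\Theta$ each term of which is an EM update, of either kind, of the preceding one. For $\theta=(\mu,J)\in\Theta$ write $$w_s(\theta)=\frac{\nu+p}{\nu+\frac{\nu}{\nu-2}d_s^2},\qquad m(\theta)=\frac{\sum_sw_s(\theta)x(s)}{\sum_sw_s(\theta)},\qquad \Sigma_{ij}(\theta,a)=\frac{\nu}{\nu-2}\,\frac1q\sum_{s=1}^qw_s(\theta)(x_i(s)-a_i)(x_j(s)-a_j).$$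 For a $V\times V$ matrix $\Sigma$ write $L(\Sigma)_{ij}=\sum_{c\in\mathcal C}(\Sigma_c^{-1})_{ij}-\sum_{s\in\mathcal S}(\Sigma_s^{-1})_{ij}$, where $\Sigma_c$ is the principal submatrix on $c$ and its inverse is extended by zero outside $c\times c$. Say that $\theta^*=(\mu^*,J^*)\in\Theta$ satisfies (E) if, with $w^*_s=w_s(\theta^*)$ and $\Sigma^*=\Sigma(\theta^*,\mu^*)$, that is $\Sigma^*_{ij}=\frac{\nu}{\nu-2}\frac1q\sum_sw^*_s(x_i(s)-\mu^*_i)(x_j(s)-\mu^*_j)$: $\mu^*=\sum_sw^*_sx(s)/\sum_sw^*_s$; all $\Sigma^*_c$ $(c\in\mathcal C)$ and $\Sigma^*_s$ $(s\in\mathcal S)$ are positive definite; and $$J^*_{ij}=\sum_{c\in\mathcal C}(\Sigma_c^{*-1})_{ij}-\sum_{s\in\mathcal S}(\Sigma_s^{*-1})_{ij}\ \text{ if } i,j \text{ lie in a common clique of }\mathcal C,\qquad J^*_{ij}=0\ \text{ otherwise.}$$ Then: 1. Every maximum likelihood solution, i.e. every maximizer $(\mu^*,J^*)$ of $\ell$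 over $\Theta$, satisfies (E), and it is a joint and a separate EM update of itself. 2. For every $\theta\in\Theta$ the EM weight $\int_0^\infty z\,f(z\mid x(s),\theta)\,dz$ equals $w_s(\theta)$ (and likewise with any $y\in\mathbb R^V$ in place of $x(s)$). 3. For $\theta\in\Theta$ the following are equivalent: $\theta$ satisfies (E); $\theta$ is a stationary point of $\ell$ on $\Theta$ (all derivatives in directions $(h,H)$ with $H$ symmetric and $H_{ij}=0$ for non-adjacent $i\neq j$ exist and vanish); $\theta$ is a joint EM update of itself; $\theta$ is a separate EM update of itself. 4. If for every clique $c\in\mathcal C$ the (unweighted) sample covariance of the variables in $c$ is positive definite, then every $\theta=(\mu,J)\in\Theta$ has exactly one joint EM update, namely $(m(\theta),L(\Sigma(\theta,m(\theta))))$, and exactly one separate EM update, namely $(m(\theta),L(\Sigma(\theta,\mu)))$. 5. Along every EM sequence $(\theta^t)$ the log-likelihood is non-decreasing. Every cluster point of $(\theta^t)$ in $\Theta$ satisfies (E). If $\theta^t\to\theta^*\in\Theta$, then $\theta^*$ satisfies (E) and the EM weights at $\theta^t$ converge to $w_s(\theta^*)$ for each $s$. If $(\theta^t)$ stays in a compact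 set $K\subseteq\Theta$ that contains only finitely many solutions of (E), then $(\theta^t)$ converges to a solution of (E) in $K$. -/

import Mathlib

open MeasureTheory Filter Topology

noncomputable section

namespace SparseStudent

/-- A clique forest of a graph `G`: a family of cliques `C i`, arranged as the vertices of a forest,
such that the edges of `G` are exactly the pairs of distinct vertices lying in a common `C i`, and
such that the cliques containing a given vertex form a (nonempty) connected part of the forest.
Maximality of the cliques is not required. A graph with such a structure is chordal. -/
structure CliqueForest {V : Type*} (G : SimpleGraph V) (ι : Type*) where
  /-- the cliques -/
  C : ι → Finset V
  /-- the forest structure on the cliques -/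
  T : SimpleGraph ι
  acyclic : T.IsAcyclic
  adj_iff : ∀ a b, G.Adj a b ↔ a ≠ b ∧ ∃ i, a ∈ C i ∧ b ∈ C i
  connected : ∀ v, (T.induce {i | v ∈ C i}).Connected

section

variable {V ι : Type*} [Fintype V] [DecidableEq V] [Fintype ι] {q : ℕ}

/-- The separator attached to an edge of the forest: the intersection of its two cliques. -/
def CliqueForest.sep {G : SimpleGraph V} (F : CliqueForest G ι) : Sym2 ι → Finset V :=
  Sym2.lift ⟨fun i j => F.C i ∩ F.C j, fun i j => Finset.inter_comm (F.C i) (F.C j)⟩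

/-- The principal submatrix on the index set `c`. -/
def block (S : Matrix V V ℝ) (c : Finset V) : Matrix c c ℝ :=
  S.submatrix (fun i => (i : V)) (fun i => (i : V))

/-- The local inverse: the inverse of the principal submatrix on `c`, placed at the positions
`c × c` and extended by zero. -/
def localInv (S : Matrix V V ℝ) (c : Finset V) : Matrix V V ℝ := fun i j =>
  if h : i ∈ c ∧ j ∈ c then (block S c)⁻¹ ⟨i, h.1⟩ ⟨j, h.2⟩ else 0

open Classical in
/-- Sum of the local inverses over the cliques minus the sum over the separators, the latter
counted with multiplicity (one term for each edge of the forest). -/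
def cliqueMinusSep {G : SimpleGraph V} (F : CliqueForest G ι) (S : Matrix V V ℝ) : Matrix V V ℝ :=
  fun i j => ∑ k, localInv S (F.C k) i j - ∑ e ∈ F.T.edgeFinset, localInv S (F.sep e) i j

/-- Parameters `(μ, J)`: `J` is positive definite and its off-diagonal entries vanish off the
edges of `G`. -/
def params (G : SimpleGraph V) : Set ((V → ℝ) × Matrix V V ℝ) :=
  {θ | θ.2.PosDef ∧ ∀ i j, i ≠ j → ¬ G.Adj i j → θ.2 i j = 0}

/-- Square of the Mahalanobis distance of `y` from the location, for `θ = (μ, J)`. -/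
def mahalanobisSq (θ : (V → ℝ) × Matrix V V ℝ) (y : V → ℝ) : ℝ :=
  (y - θ.1) ⬝ᵥ (θ.2.mulVec (y - θ.1))

/-- Log-likelihood of the multivariate Student-t with `ν` degrees of freedom, location `μ` and
inverse covariance `J`, for the observations `x 0, …, x (q-1)`. -/
def logLik (ν : ℝ) (x : Fin q → V → ℝ) (θ : (V → ℝ) × Matrix V V ℝ) : ℝ :=
  (q : ℝ) * Real.log (Real.Gamma ((ν + Fintype.card V) / 2) /
      ((ν - 2) ^ ((Fintype.card V : ℝ) / 2) * Real.pi ^ ((Fintype.card V : ℝ) / 2)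
        * Real.Gamma (ν / 2)))
    + (q : ℝ) / 2 * Real.log θ.2.det
    - (ν + Fintype.card V) / 2 * ∑ s, Real.log (1 + 1 / (ν - 2) * mahalanobisSq θ (x s))

/-- Maximum likelihood solution of the sparse Student-t problem. -/
def IsMLSolution (G : SimpleGraph V) (ν : ℝ) (x : Fin q → V → ℝ)
    (θ : (V → ℝ) × Matrix V V ℝ) : Prop :=
  θ ∈ params G ∧ ∀ η ∈ params G, logLik ν x η ≤ logLik ν x θ

/-- Stationary point of the log-likelihood: all derivatives in the directions allowed by the
sparsity constraint vanish. -/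
def IsStationary (G : SimpleGraph V) (ν : ℝ) (x : Fin q → V → ℝ)
    (θ : (V → ℝ) × Matrix V V ℝ) : Prop :=
  ∀ (h : V → ℝ) (H : Matrix V V ℝ), H.IsSymm → (∀ i j, i ≠ j → ¬ G.Adj i j → H i j = 0) →
    HasDerivAt (fun t : ℝ => logLik ν x (θ.1 + t • h, θ.2 + t • H)) 0 0

/-! ### The expectation-maximization iteration -/

/-- Normal density with location `μ` and inverse covariance `(ν / (ν - 2)) z J`. -/
def normalDensity (ν : ℝ) (θ : (V → ℝ) × Matrix V V ℝ) (y : V → ℝ) (z : ℝ) : ℝ :=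
  Real.sqrt (z ^ Fintype.card V * ν ^ Fintype.card V * θ.2.det /
      (2 * Real.pi * (ν - 2)) ^ Fintype.card V)
    * Real.exp (-(z / 2 * (ν / (ν - 2)) * mahalanobisSq θ y))

/-- Joint density of the observation `y` and the latent mixing variable `z`. -/
def jointDensity (ν : ℝ) (θ : (V → ℝ) × Matrix V V ℝ) (y : V → ℝ) (z : ℝ) : ℝ :=
  ProbabilityTheory.gammaPDFReal (ν / 2) (ν / 2) z * normalDensity ν θ y z

/-- Conditional density of the latent variable `z` given the observation `y`. -/
def posterior (ν : ℝ) (θ : (V → ℝ) × Matrix V V ℝ) (y : V → ℝ) (z : ℝ) : ℝ :=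
  jointDensity ν θ y z / ∫ u in Set.Ioi (0 : ℝ), jointDensity ν θ y u

/-- The expectation `Q(η | θ)` of the E-step. -/
def emQ (ν : ℝ) (x : Fin q → V → ℝ) (η θ : (V → ℝ) × Matrix V V ℝ) : ℝ :=
  ∑ s, ∫ z in Set.Ioi (0 : ℝ), posterior ν θ (x s) z * Real.log (jointDensity ν η (x s) z)

/-- The EM weight of an observation: the conditional mean of the latent variable. -/
def emWeight (ν : ℝ) (θ : (V → ℝ) × Matrix V V ℝ) (y : V → ℝ) : ℝ :=
  ∫ z in Set.Ioi (0 : ℝ), z * posterior ν θ y z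

/-- EM update with a joint M-step: `θ'` maximizes `Q(· | θ)` over all parameters. -/
def IsEMStep (G : SimpleGraph V) (ν : ℝ) (x : Fin q → V → ℝ)
    (θ θ' : (V → ℝ) × Matrix V V ℝ) : Prop :=
  θ' ∈ params G ∧ ∀ η ∈ params G, emQ ν x η θ ≤ emQ ν x θ' θ

/-- EM update with a separate M-step: the new location maximizes `Q(· | θ)` in the location
argument, and the new `J` maximizes `Q(· | θ)` in the `J` argument with the location kept at its
current value. -/
def IsSeparateEMStep (G : SimpleGraph V) (ν : ℝ) (x : Fin q → V → ℝ)
    (θ θ' : (V → ℝ) × Matrix V V ℝ) : Prop :=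
  θ' ∈ params G ∧ (∀ m, emQ ν x (m, θ'.2) θ ≤ emQ ν x θ' θ) ∧
    ∀ η ∈ params G, emQ ν x (θ.1, η.2) θ ≤ emQ ν x (θ.1, θ'.2) θ

/-- A run of the EM iteration; each M-step may be joint or separate. -/
def IsEMSequence (G : SimpleGraph V) (ν : ℝ) (x : Fin q → V → ℝ)
    (θ : ℕ → (V → ℝ) × Matrix V V ℝ) : Prop :=
  θ 0 ∈ params G ∧
    ∀ t, IsEMStep G ν x (θ t) (θ (t + 1)) ∨ IsSeparateEMStep G ν x (θ t) (θ (t + 1))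

/-! ### The closed forms -/

/-- The explicit weight `(ν + p) / (ν + (ν / (ν - 2)) d²)`. -/
def studentWeight (ν : ℝ) (θ : (V → ℝ) × Matrix V V ℝ) (y : V → ℝ) : ℝ :=
  (ν + Fintype.card V) / (ν + ν / (ν - 2) * mahalanobisSq θ y)

/-- Weighted mean of the observations. -/
def weightedMean (w : Fin q → ℝ) (x : Fin q → V → ℝ) : V → ℝ :=
  (∑ s, w s)⁻¹ • ∑ s, w s • x s

/-- Weighted sample covariance `(1/q) ∑ₛ wₛ (xᵢ(s) - mᵢ)(xⱼ(s) - mⱼ)` around `m`. -/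
def weightedCov (w : Fin q → ℝ) (x : Fin q → V → ℝ) (m : V → ℝ) : Matrix V V ℝ :=
  fun i j => 1 / (q : ℝ) * ∑ s, w s * ((x s i - m i) * (x s j - m j))

/-- The covariance estimator `(ν / (ν - 2)) (1/q) ∑ₛ wₛ (xᵢ(s) - mᵢ)(xⱼ(s) - mⱼ)`, with the
weights `wₛ` computed at the parameter `θ`. -/
def emCov (ν : ℝ) (x : Fin q → V → ℝ) (θ : (V → ℝ) × Matrix V V ℝ) (m : V → ℝ) : Matrix V V ℝ :=
  (ν / (ν - 2)) • weightedCov (fun s => studentWeight ν θ (x s)) x m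

/-- The self-consistent equations for `θ = (μ*, J*)`, with weights `w*` and covariances `Σ*`
computed at `θ` itself. -/
structure SolvesEquations {G : SimpleGraph V} (F : CliqueForest G ι) (ν : ℝ) (x : Fin q → V → ℝ)
    (θ : (V → ℝ) × Matrix V V ℝ) : Prop where
  mean_eq : θ.1 = weightedMean (fun s => studentWeight ν θ (x s)) x
  clique_posDef : ∀ k, (block (emCov ν x θ θ.1) (F.C k)).PosDef
  sep_posDef : ∀ e ∈ F.T.edgeSet, (block (emCov ν x θ θ.1) (F.sep e)).PosDef
  entry_eq : ∀ i j, (∃ k, i ∈ F.C k ∧ j ∈ F.C k) →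
    θ.2 i j = cliqueMinusSep F (emCov ν x θ θ.1) i j
  entry_zero : ∀ i j, (¬ ∃ k, i ∈ F.C k ∧ j ∈ F.C k) → θ.2 i j = 0

end

end SparseStudent

end

/-! Everything passes through one condition, `IsMomentMatched`: the location is the weighted mean,
and the inverse of J agrees with the weighted covariance on the diagonal and on the edges. ML
solutions satisfy it; for an admissible parameter, stationarity, being fixed by either kind of EM
update, and the clique-minus-separator equations are each equivalent to it.

Linear algebra. If the clique blocks of S are positive definite, the clique-minus-separator sum L(S)
is an admissible precision matrix whose inverse agrees with S on the cliques
(`CliqueForest.cliqueMinusSep_posDef`). This is proved by attaching the cliques one at a time at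
leaves of the forest (`glue_clique`): probabilistically, the new coordinates are a regression on the
separator plus independent noise. Such a matrix is unique, because A ↦ A⁻¹ is strictly monotone
(decreasing) and the difference of two admissible matrices vanishes wherever their inverses may
differ (`eq_of_agreeOn_inv`). Concavity of log det turns the matching condition into maximality of
the Gaussian objective log|J| - tr(SJ).

Statistics. Given an observation, the latent variable is Gamma distributed with the Student weight
as mean. Hence Q(· | θ) is, up to a constant and a factor, the Gaussian objective of a weighted
covariance (`emQ_eq`, `emQ_eq_gaussObj`), and both M-steps amount to moment matching. The tangent
inequality for log gives Q(η|θ) - Q(θ|θ) ≤ ℓ(η) - ℓ(θ) (`emQ_sub_le_logLik_sub`), hence monotonicity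
and the fact that ML solutions are EM fixed points.

Dynamics. Near a cluster point the likelihood gains tend to 0, so the gains in Q do too, and the
cluster point is a fixed point; only then is the EM map known to be continuous there, so successors
have the same limit (`IsEMSequence.ultrafilter_limit`). In a compact set with finitely many fixed
points the sequence cannot keep leaving a small neighbourhood of one of them, so it converges
(`exists_tendsto_of_finite_limits`). -/

noncomputable section

namespace SparseStudent

open Matrix

set_option linter.unusedSectionVars false
set_option linter.unusedFintypeInType false

/-! ### Local inverses as products with coordinate projectors -/

section LocalInverse

variable {V : Type*} [Fintype V] [DecidableEq V]

/-- The matrix selecting the coordinates in `c`. -/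
def coordSel (c : Finset V) : Matrix c V ℝ := (1 : Matrix V V ℝ).submatrix (fun i => (i : V)) id

/-- The diagonal projector onto the coordinates in `c`. -/
def coordProj (c : Finset V) : Matrix V V ℝ := diagonal fun i => if i ∈ c then 1 else 0

lemma coordProj_transpose (c : Finset V) : (coordProj c)ᵀ = coordProj c := by
  simp [coordProj]

lemma coordProj_mul_coordProj (c d : Finset V) :
    coordProj c * coordProj d = coordProj (c ∩ d) := by
  simp only [coordProj, diagonal_mul_diagonal]
  congr 1
  ext i
  by_cases h : i ∈ c <;> simp [h]

lemma coordProj_mul_eq_zero {c d : Finset V} (h : Disjoint c d) :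
    coordProj c * coordProj d = 0 := by
  rw [coordProj_mul_coordProj, Finset.disjoint_iff_inter_eq_empty.1 h]
  simp [coordProj]

lemma coordProj_mul_of_subset {c d : Finset V} (h : c ⊆ d) :
    coordProj c * coordProj d = coordProj c := by
  rw [coordProj_mul_coordProj, Finset.inter_eq_left.2 h]

lemma coordProj_mul_of_superset {c d : Finset V} (h : d ⊆ c) :
    coordProj c * coordProj d = coordProj d := by
  rw [coordProj_mul_coordProj, Finset.inter_eq_right.2 h]

lemma coordProj_add_of_disjoint {c d : Finset V} (h : Disjoint c d) :
    coordProj c + coordProj d = coordProj (c ∪ d) := by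
  simp only [coordProj, diagonal_add]
  congr 1
  ext i
  by_cases h1 : i ∈ c
  · simp [h1, Finset.disjoint_left.1 h h1]
  · simp [h1]

lemma coordProj_conj_apply (c d : Finset V) (A : Matrix V V ℝ) (i j : V) :
    (coordProj c * A * coordProj d) i j = if i ∈ c ∧ j ∈ d then A i j else 0 := by
  rw [coordProj, coordProj, mul_diagonal, diagonal_mul]
  by_cases h1 : i ∈ c <;> by_cases h2 : j ∈ d <;> simp [h1, h2]

lemma coordProj_conj_eq_iff (c : Finset V) (A B : Matrix V V ℝ) :
    coordProj c * A * coordProj c = coordProj c * B * coordProj c ↔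
      ∀ i ∈ c, ∀ j ∈ c, A i j = B i j := by
  constructor
  · intro h i hi j hj
    have := congrFun (congrFun h i) j
    simpa [coordProj_conj_apply, hi, hj] using this
  · intro h
    ext i j
    rw [coordProj_conj_apply, coordProj_conj_apply]
    split_ifs with hij
    · exact h i hij.1 j hij.2
    · rfl

lemma coordSel_mul_transpose (c : Finset V) : coordSel c * (coordSel c)ᵀ = 1 := by
  ext i j
  simp only [coordSel, mul_apply, transpose_apply, submatrix_apply, one_apply, id,
    Subtype.ext_iff, ite_mul, one_mul, zero_mul, Finset.sum_ite_eq, Finset.mem_univ, if_true]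
  exact if_congr eq_comm rfl rfl

lemma coordSel_transpose_mul (c : Finset V) : (coordSel c)ᵀ * coordSel c = coordProj c := by
  ext i j
  simp only [coordSel, mul_apply, transpose_apply, submatrix_apply, one_apply, coordProj,
    diagonal_apply, id]
  rw [Finset.sum_coe_sort c (fun k => (if k = i then (1 : ℝ) else 0) * if k = j then 1 else 0)]
  by_cases hi : i ∈ c
  · by_cases hij : j = i
    · simp [hij, hi]
    · simp [hij, Ne.symm hij]
  · by_cases hij : j = i
    · simp [hij, hi]
    · simp [hij, Ne.symm hij]

lemma block_eq (S : Matrix V V ℝ) (c : Finset V) :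
    block S c = coordSel c * S * (coordSel c)ᵀ := by
  ext i j
  simp [block, coordSel, mul_apply, one_apply]

/-- This form lets block inversion be carried out as algebra among V × V matrices, without
reindexing by subtypes. -/
lemma localInv_eq (S : Matrix V V ℝ) (c : Finset V) :
    localInv S c = (coordSel c)ᵀ * (block S c)⁻¹ * coordSel c := by
  ext i j
  simp only [coordSel, mul_apply, transpose_apply, submatrix_apply, one_apply, id, localInv]
  split_ifs with h
  · rw [Finset.sum_eq_single ⟨j, h.2⟩, Finset.sum_eq_single ⟨i, h.1⟩]
    · simp
    · intro b _ hb; simp [Subtype.ext_iff] at hb; simp [hb]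
    · simp
    · intro b _ hb; simp [Subtype.ext_iff] at hb; simp [hb]
    · simp
  · symm
    apply Finset.sum_eq_zero
    intro k _
    by_cases hk : (k : V) = j
    · rw [Finset.sum_eq_zero, zero_mul]
      intro l _
      have : (l : V) ≠ i := fun hl => h ⟨hl ▸ l.2, hk ▸ k.2⟩
      simp [this]
    · simp [hk]

lemma coordSel_mul_coordProj (c : Finset V) : coordSel c * coordProj c = coordSel c := by
  rw [← coordSel_transpose_mul, ← Matrix.mul_assoc, coordSel_mul_transpose, Matrix.one_mul]

lemma coordProj_mul_coordSel_transpose (c : Finset V) :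
    coordProj c * (coordSel c)ᵀ = (coordSel c)ᵀ := by
  rw [← coordSel_transpose_mul, Matrix.mul_assoc, coordSel_mul_transpose, Matrix.mul_one]

lemma coordProj_mul_localInv (S : Matrix V V ℝ) (c : Finset V) :
    coordProj c * localInv S c = localInv S c := by
  rw [localInv_eq, ← Matrix.mul_assoc, ← Matrix.mul_assoc, coordProj_mul_coordSel_transpose]

lemma localInv_mul_coordProj (S : Matrix V V ℝ) (c : Finset V) :
    localInv S c * coordProj c = localInv S c := by
  rw [localInv_eq, Matrix.mul_assoc, coordSel_mul_coordProj]

lemma localInv_mul_coordProj_eq_zero (S : Matrix V V ℝ) {c d : Finset V} (h : Disjoint c d) :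
    localInv S c * coordProj d = 0 := by
  rw [← localInv_mul_coordProj, Matrix.mul_assoc, coordProj_mul_eq_zero h, Matrix.mul_zero]

lemma localInv_mul_mul_coordProj {S : Matrix V V ℝ} {c : Finset V} (h : (block S c).PosDef) :
    localInv S c * S * coordProj c = coordProj c := by
  have hu : IsUnit (block S c).det := (isUnit_iff_isUnit_det _).1 h.isUnit
  calc localInv S c * S * coordProj c
      = (coordSel c)ᵀ * ((block S c)⁻¹ * block S c) * coordSel c := by
        rw [localInv_eq, ← coordSel_transpose_mul]
        conv_rhs => rw [block_eq S c]
        simp only [Matrix.mul_assoc, block_eq]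
    _ = coordProj c := by rw [nonsing_inv_mul _ hu, Matrix.mul_one, coordSel_transpose_mul]

lemma localInv_transpose {S : Matrix V V ℝ} (hS : S.IsSymm) (c : Finset V) :
    (localInv S c)ᵀ = localInv S c := by
  have : (block S c)ᵀ = block S c := by
    rw [block, transpose_submatrix, hS.eq]
  rw [localInv_eq, transpose_mul, transpose_mul, transpose_transpose, transpose_nonsing_inv, this,
    Matrix.mul_assoc]

lemma coordProj_mul_mul_localInv {S : Matrix V V ℝ} (hS : S.IsSymm) {c : Finset V}
    (h : (block S c).PosDef) : coordProj c * S * localInv S c = coordProj c := by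
  have := congrArg transpose (localInv_mul_mul_coordProj h)
  rwa [transpose_mul, transpose_mul, coordProj_transpose, localInv_transpose hS, hS.eq,
    ← Matrix.mul_assoc] at this

lemma localInv_quadForm_pos {S : Matrix V V ℝ} {c : Finset V} (h : (block S c).PosDef)
    {y : V → ℝ} (hy : coordProj c *ᵥ y = y) (h0 : y ≠ 0) : 0 < y ⬝ᵥ (localInv S c *ᵥ y) := by
  have hne : coordSel c *ᵥ y ≠ 0 := by
    intro h1
    apply h0
    rw [← hy, ← coordSel_transpose_mul, ← mulVec_mulVec, h1, mulVec_zero]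
  have := h.inv.dotProduct_mulVec_pos hne
  rw [localInv_eq, ← mulVec_mulVec, ← mulVec_mulVec, dotProduct_mulVec, vecMul_transpose]
  simpa using this

lemma block_posDef_of_subset {S : Matrix V V ℝ} {c s : Finset V} (hs : s ⊆ c)
    (h : (block S c).PosDef) : (block S s).PosDef :=
  h.submatrix (e := fun i : s => (⟨i, hs i.2⟩ : c)) fun i j hij => by
    exact Subtype.ext (congrArg (fun k : c => (k : V)) hij)

end LocalInverse

/-! ### Attaching one clique along a separator -/

section GlueAlgebra

variable {V : Type*} [Fintype V] [DecidableEq V]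
  {S M N E R X Y : Matrix V V ℝ}

/-- Here E and R project onto s and c \ s, and X and Y are the local inverses of S on c and s. The
matrix W = R - R S Y takes the residual of the regression of c \ s on s, and X - Y = Wᵀ X W is the
Schur complement identity: joint precision minus marginal precision is the precision of the
conditional law. -/
lemma glue_factor (hST : Sᵀ = S) (hXT : Xᵀ = X) (hYT : Yᵀ = Y) (hRT : Rᵀ = R)
    (hXS : X * S * (E + R) = E + R) (hSY : E * S * Y = E) (hXE : X * (E + R) = X)
    (hEY : E * Y = Y) (hRY : R * Y = 0) :
    X * R * S * Y = Y - X * E ∧ X - Y = (R - Y * S * R) * X ∧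
      X - Y = (R - R * S * Y)ᵀ * X * (R - R * S * Y) := by
  have hYR : Y * R = 0 := by
    have := congrArg transpose hRY
    rwa [transpose_mul, hRT, hYT, transpose_zero] at this
  have hXSY : X * S * Y = Y := by
    have : X * S * (E + R) * Y = (E + R) * Y := by rw [hXS]
    rw [Matrix.mul_assoc, Matrix.add_mul, hEY, hRY, add_zero] at this
    exact this
  have hXRSY : X * R * S * Y = Y - X * E := by
    have h1 : X * (E + R) * S * Y = Y := by rw [hXE, hXSY]
    have h2 : X * E * S * Y = X * E := by
      calc X * E * S * Y = X * (E * S * Y) := by simp only [Matrix.mul_assoc]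
        _ = X * E := by rw [hSY]
    rw [Matrix.mul_add, Matrix.add_mul, Matrix.add_mul, h2] at h1
    exact eq_sub_of_add_eq' h1
  have hΔ : X - Y = X * (R - R * S * Y) := by
    have : X * (R - R * S * Y) = X * R - X * R * S * Y := by
      simp only [Matrix.mul_sub, Matrix.mul_assoc]
    rw [this, hXRSY]
    have h2 : X * E + X * R = X := by rw [← Matrix.mul_add, hXE]
    nth_rewrite 1 [← h2]
    abel
  have hWT : (R - R * S * Y)ᵀ = R - Y * S * R := by
    rw [transpose_sub, transpose_mul, transpose_mul, hRT, hST, hYT, Matrix.mul_assoc]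
  have hΔ' : X - Y = (R - Y * S * R) * X := by
    have := congrArg transpose hΔ
    rwa [transpose_sub, transpose_mul, hXT, hYT, hWT] at this
  refine ⟨hXRSY, hΔ', ?_⟩
  rw [hWT, ← hΔ', Matrix.sub_mul, ← hΔ, Matrix.mul_sub, hYR, ← Matrix.mul_assoc,
    ← Matrix.mul_assoc, hYR]
  simp

/-- The inverse is the covariance obtained from N by replacing the identity on c \ s with the
conditional covariance T = R S R - R S Y S R, followed by the shear 1 + R S Y that adds the
regression on s. Multiplying the factors one at a time removes the shear, then N - R + T, then the
transposed shear. -/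
lemma glue_mul_inv (hXRSY : X * R * S * Y = Y - X * E)
    (hΔ : X - Y = (R - R * S * Y)ᵀ * X * (R - R * S * Y))
    (hΔ' : X - Y = (R - Y * S * R) * X) (hWT : (R - R * S * Y)ᵀ = R - Y * S * R)
    (hXS : X * S * (E + R) = E + R) (hXE : X * (E + R) = X)
    (hER : E * R = 0) (hRR : R * R = R) (hRY : R * Y = 0) (hYR : Y * R = 0)
    (hMR : M * R = R) (hRN : R * N = R) (hMN : M * N = 1) :
    (M - R + X - Y) * ((1 + R * S * Y) * (N - R + (R * S * R - R * S * Y * S * R)) *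
      (1 + Y * S * R)) = 1 := by
  set T := R * S * R - R * S * Y * S * R with hT
  have hRT : R * T = T := by
    rw [hT, Matrix.mul_sub]; simp only [← Matrix.mul_assoc, hRR]
  have hXT : X * T = R - Y * S * R := by
    have h1 : X * S * R = R := by
      have := congrArg (· * R) hXS
      simpa only [Matrix.mul_assoc, Matrix.add_mul, hER, hRR, zero_add] using this
    have h2 : X * T = X * R * S * R - X * R * S * Y * S * R := by
      rw [hT]; simp only [Matrix.mul_sub, Matrix.mul_assoc]
    have h3 : X * E * S * R + X * R * S * R = X * S * R := by
      rw [← Matrix.add_mul, ← Matrix.add_mul, ← Matrix.mul_add, hXE]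
    rw [h1] at h3
    rw [h2, hXRSY, Matrix.sub_mul, Matrix.sub_mul]
    nth_rewrite 5 [← h3]
    abel
  have h1 : (M - R + X - Y) * (1 + R * S * Y) = M - R + X * R := by
    have ha : (M - R) * (R * S * Y) = 0 := by
      rw [← Matrix.mul_assoc, ← Matrix.mul_assoc, Matrix.sub_mul, hMR, hRR]; simp
    have hb : (R - R * S * Y) * (1 + R * S * Y) = R := by
      have : R * S * Y * (R * S * Y) = 0 := by
        calc R * S * Y * (R * S * Y) = R * S * (Y * R) * S * Y := by simp only [Matrix.mul_assoc]
          _ = 0 := by rw [hYR]; simp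
      have h5 : R * (R * S * Y) = R * S * Y := by simp only [← Matrix.mul_assoc, hRR]
      rw [Matrix.sub_mul, Matrix.mul_add, Matrix.mul_add, this, h5]; simp
    have hc : (X - Y) * (1 + R * S * Y) = X * R := by
      nth_rewrite 1 [hΔ]
      rw [Matrix.mul_assoc, hb, hWT, ← hΔ', Matrix.sub_mul, hYR, sub_zero]
    rw [add_sub_assoc, Matrix.add_mul, hc, Matrix.mul_add, ha]; simp
  have h2 : (M - R + X * R) * (N - R + T) = 1 - Y * S * R := by
    have hMT : M * T = T := by rw [← hRT, ← Matrix.mul_assoc, hMR]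
    have ha : (M - R) * (N - R + T) = 1 - R := by
      simp only [Matrix.sub_mul, Matrix.mul_add, Matrix.mul_sub, hMN, hMR, hRN, hRR, hMT, hRT]
      abel
    have hb : X * R * (N - R + T) = X * T := by
      rw [Matrix.mul_assoc, Matrix.mul_add, Matrix.mul_sub, hRN, hRR, hRT]; simp
    rw [Matrix.add_mul, ha, hb, hXT]; abel
  have h3 : Y * S * R * (Y * S * R) = 0 := by
    calc Y * S * R * (Y * S * R) = Y * S * (R * Y) * S * R := by simp only [Matrix.mul_assoc]
      _ = 0 := by rw [hRY]; simp
  rw [← Matrix.mul_assoc, ← Matrix.mul_assoc, h1, h2, Matrix.sub_mul, Matrix.mul_add,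
    Matrix.mul_add, h3]
  simp

/-- The shears and the replaced block alter only rows and columns in the range of R, which 1 - R
kills. -/
lemma glue_inv_old (hRR : R * R = R) :
    (1 - R) * ((1 + R * S * Y) * (N - R + (R * S * R - R * S * Y * S * R)) *
      (1 + Y * S * R)) * (1 - R) = (1 - R) * N * (1 - R) := by
  have h1 : (1 - R) * R = 0 := by rw [Matrix.sub_mul, hRR]; simp
  have h2 : R * (1 - R) = 0 := by rw [Matrix.mul_sub, hRR]; simp
  have h3 : (1 - R) * (1 + R * S * Y) = 1 - R := by
    rw [Matrix.mul_add, ← Matrix.mul_assoc, ← Matrix.mul_assoc, h1]; simp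
  have h4 : (1 + Y * S * R) * (1 - R) = 1 - R := by
    rw [Matrix.add_mul, Matrix.mul_assoc _ R, h2]; simp
  have h5 : (1 - R) * (N - R + (R * S * R - R * S * Y * S * R)) = (1 - R) * N := by
    simp only [Matrix.mul_add (1 - R), Matrix.mul_sub (1 - R), ← Matrix.mul_assoc, h1]; simp
  rw [Matrix.mul_assoc, Matrix.mul_assoc _ (1 + _), h4, ← Matrix.mul_assoc, ← Matrix.mul_assoc, h3,
    h5]

/-- On s the old covariance N agrees with S, so regression on s reproduces the cross covariances,
and regression plus the conditional covariance reproduces the block of S on c \ s. -/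
lemma glue_inv_new (hRR : R * R = R) (hRE : R * E = 0) (hER : E * R = 0)
    (hRN : R * N = R) (hNR : N * R = R) (hYR : Y * R = 0) (hRY : R * Y = 0)
    (hYE : Y * E = Y) (hEY : E * Y = Y) (hYS : Y * S * E = E) (hSY : E * S * Y = E)
    (hNS : E * N * E = E * S * E) :
    (E + R) * ((1 + R * S * Y) * (N - R + (R * S * R - R * S * Y * S * R)) *
      (1 + Y * S * R)) * (E + R) = (E + R) * S * (E + R) := by
  have h1 : (E + R) * (1 + R * S * Y) = E + R + R * S * Y := by
    rw [Matrix.add_mul, Matrix.mul_add, Matrix.mul_add, ← Matrix.mul_assoc, ← Matrix.mul_assoc,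
      ← Matrix.mul_assoc, ← Matrix.mul_assoc, hER, hRR]
    simp; abel
  have h2 : (1 + Y * S * R) * (E + R) = E + R + Y * S * R := by
    rw [Matrix.mul_add, Matrix.add_mul, Matrix.add_mul, Matrix.mul_assoc _ R, Matrix.mul_assoc _ R,
      hRE, hRR]
    simp; abel
  have h3 : (E + R + R * S * Y) * (N - R + (R * S * R - R * S * Y * S * R)) =
      E * N + R * S * Y * N + (R * S * R - R * S * Y * S * R) := by
    have a1 : R * S * Y * R = 0 := by rw [Matrix.mul_assoc, hYR, Matrix.mul_zero]
    simp only [Matrix.add_mul, Matrix.mul_add, Matrix.mul_sub, ← Matrix.mul_assoc, hER, hRN, hRR,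
      a1, Matrix.zero_mul]
    abel
  have hYNE : Y * N * E = E := by
    calc Y * N * E = Y * (E * N * E) := by
          rw [← Matrix.mul_assoc, ← Matrix.mul_assoc, hYE]
      _ = E := by rw [hNS, ← Matrix.mul_assoc, ← Matrix.mul_assoc, hYE, hYS]
  have hENY : E * N * Y = E := by
    calc E * N * Y = E * N * E * Y := by rw [Matrix.mul_assoc _ E, hEY]
      _ = E := by rw [hNS, Matrix.mul_assoc _ E, hEY, hSY]
  have hYNY : Y * N * Y = Y := by
    calc Y * N * Y = Y * N * E * Y := by rw [Matrix.mul_assoc _ E, hEY]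
      _ = Y := by rw [hYNE, hEY]
  have h4 : (E * N + R * S * Y * N + (R * S * R - R * S * Y * S * R)) * (E + R + Y * S * R) =
      (E + R) * S * (E + R) := by
    have b1 : E * N * R = 0 := by rw [Matrix.mul_assoc, hNR, hER]
    have b2 : E * N * (Y * S * R) = E * S * R := by
      rw [← Matrix.mul_assoc, ← Matrix.mul_assoc, hENY]
    have b3 : R * S * Y * N * E = R * S * E := by
      rw [Matrix.mul_assoc _ Y, Matrix.mul_assoc, hYNE]
    have b4 : R * S * Y * N * R = 0 := by
      rw [Matrix.mul_assoc _ N, hNR, Matrix.mul_assoc, hYR, Matrix.mul_zero]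
    have b5 : R * S * Y * N * (Y * S * R) = R * S * Y * S * R := by
      calc R * S * Y * N * (Y * S * R) = R * S * (Y * N * Y) * S * R := by
            simp only [Matrix.mul_assoc]
        _ = R * S * Y * S * R := by rw [hYNY]
    have b6 : ∀ Z : Matrix V V ℝ, Z * R * E = 0 := fun Z => by
      rw [Matrix.mul_assoc, hRE, Matrix.mul_zero]
    have b7 : ∀ Z : Matrix V V ℝ, Z * R * R = Z * R := fun Z => by rw [Matrix.mul_assoc, hRR]
    have b8 : ∀ Z : Matrix V V ℝ, Z * R * (Y * S * R) = 0 := fun Z => by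
      calc Z * R * (Y * S * R) = Z * (R * Y) * S * R := by simp only [Matrix.mul_assoc]
        _ = 0 := by rw [hRY]; simp
    simp only [Matrix.add_mul, Matrix.mul_add, Matrix.sub_mul, hNS, b1, b2, b3, b4, b5, b6, b7, b8]
    abel
  rw [← Matrix.mul_assoc, ← Matrix.mul_assoc, h1, h3, Matrix.mul_assoc, h2, h4]

/-- Gluing a clique `c` along a separator `s ⊆ c`: if `M` is positive definite, is the identity on
`c \ s`, and `M⁻¹` agrees with `S` on `s`, then the enlarged matrix is positive definite, and its
inverse is unchanged off `c \ s` and agrees with `S` on `c`. -/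
theorem glue_clique (hS : S.IsSymm) {c s : Finset V} (hsc : s ⊆ c)
    (hc : (block S c).PosDef) (hM : M.PosDef)
    (hMR : M * coordProj (c \ s) = coordProj (c \ s))
    (hMs : ∀ i ∈ s, ∀ j ∈ s, M⁻¹ i j = S i j) :
    (M - coordProj (c \ s) + localInv S c - localInv S s).PosDef ∧
    (∀ i ∉ c \ s, ∀ j ∉ c \ s,
      (M - coordProj (c \ s) + localInv S c - localInv S s)⁻¹ i j = M⁻¹ i j) ∧
    ∀ i ∈ c, ∀ j ∈ c, (M - coordProj (c \ s) + localInv S c - localInv S s)⁻¹ i j = S i j := by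
  have hs := block_posDef_of_subset hsc hc
  have hMT : Mᵀ = M := by simpa using hM.isHermitian.eq
  have hMdet : IsUnit M.det := (isUnit_iff_isUnit_det _).1 hM.isUnit
  have hMN : M * M⁻¹ = 1 := mul_nonsing_inv _ hMdet
  have hNM : M⁻¹ * M = 1 := nonsing_inv_mul _ hMdet
  have hNT : M⁻¹ᵀ = M⁻¹ := by rw [transpose_nonsing_inv, hMT]
  have hST : Sᵀ = S := hS.eq
  have hER : coordProj s + coordProj (c \ s) = coordProj c := by
    rw [coordProj_add_of_disjoint Finset.disjoint_sdiff, Finset.union_sdiff_of_subset hsc]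
  have hsR : coordProj s * coordProj (c \ s) = 0 := coordProj_mul_eq_zero Finset.disjoint_sdiff
  have hRs : coordProj (c \ s) * coordProj s = 0 := coordProj_mul_eq_zero Finset.sdiff_disjoint
  have hRR : coordProj (c \ s) * coordProj (c \ s) = coordProj (c \ s) :=
    coordProj_mul_of_subset subset_rfl
  have hRT := coordProj_transpose (c \ s)
  have hXT := localInv_transpose hS c
  have hYT := localInv_transpose hS s
  have hYE := localInv_mul_coordProj S s
  have hEY := coordProj_mul_localInv S s
  have hYR : localInv S s * coordProj (c \ s) = 0 := by
    rw [← hYE, Matrix.mul_assoc, hsR, Matrix.mul_zero]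
  have hRY : coordProj (c \ s) * localInv S s = 0 := by
    rw [← hEY, ← Matrix.mul_assoc, hRs, Matrix.zero_mul]
  have hXS : localInv S c * S * (coordProj s + coordProj (c \ s)) =
      coordProj s + coordProj (c \ s) := by rw [hER, localInv_mul_mul_coordProj hc]
  have hXE : localInv S c * (coordProj s + coordProj (c \ s)) = localInv S c := by
    rw [hER, localInv_mul_coordProj]
  have hSY := coordProj_mul_mul_localInv hS hs
  have hNR : M⁻¹ * coordProj (c \ s) = coordProj (c \ s) := by
    conv_lhs => rw [← hMR, ← Matrix.mul_assoc, hNM, Matrix.one_mul]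
  have hRN : coordProj (c \ s) * M⁻¹ = coordProj (c \ s) := by
    have := congrArg transpose hNR
    rwa [transpose_mul, hRT, hNT] at this
  have hRM : coordProj (c \ s) * M = coordProj (c \ s) := by
    have := congrArg transpose hMR
    rwa [transpose_mul, hRT, hMT] at this
  obtain ⟨f1, f2, f3⟩ := glue_factor hST hXT hYT hRT hXS hSY hXE hEY hRY
  have hWT : (coordProj (c \ s) - coordProj (c \ s) * S * localInv S s)ᵀ =
      coordProj (c \ s) - localInv S s * S * coordProj (c \ s) := by
    rw [transpose_sub, transpose_mul, transpose_mul, hRT, hST, hYT, Matrix.mul_assoc]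
  have hinv := inv_eq_right_inv
    (glue_mul_inv f1 f3 f2 hWT hXS hXE hsR hRR hRY hYR hMR hRN hMN)
  refine ⟨?_, ?_, ?_⟩
  · refine PosDef.of_dotProduct_mulVec_pos ?_ ?_
    · simp only [IsHermitian, conjTranspose_eq_transpose_of_trivial, transpose_sub, transpose_add,
        hMT, hRT, hXT, hYT]
    · intro y hy
      set R := coordProj (c \ s) with hR
      set W := R - R * S * localInv S s with hW
      have e1 : M - R = (1 - R)ᵀ * M * (1 - R) := by
        rw [transpose_sub, transpose_one, hRT, Matrix.sub_mul, Matrix.one_mul, hRM, Matrix.mul_sub,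
          Matrix.mul_one, Matrix.sub_mul, hMR, hRR]
        simp
      have e2 : M - R + localInv S c - localInv S s =
          (1 - R)ᵀ * M * (1 - R) + Wᵀ * localInv S c * W := by
        rw [add_sub_assoc, f3, e1]
      have e3 : star y ⬝ᵥ ((M - R + localInv S c - localInv S s) *ᵥ y) =
          ((1 - R) *ᵥ y) ⬝ᵥ (M *ᵥ ((1 - R) *ᵥ y)) + (W *ᵥ y) ⬝ᵥ (localInv S c *ᵥ (W *ᵥ y)) := by
        rw [e2, star_trivial, add_mulVec, dotProduct_add]
        congr 1 <;>
        rw [← mulVec_mulVec, ← mulVec_mulVec, dotProduct_mulVec, vecMul_transpose]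
      have hRW : coordProj c *ᵥ (W *ᵥ y) = W *ᵥ y := by
        have : coordProj c * R = R := coordProj_mul_of_superset Finset.sdiff_subset
        rw [mulVec_mulVec, hW, Matrix.mul_sub, ← Matrix.mul_assoc, ← Matrix.mul_assoc, this]
      rw [e3]
      -- The form is now a sum of two nonnegative terms. If the first vanishes, y is supported on c
      -- \ s, where W acts as the identity, and the second term is positive.
      by_cases h0 : (1 - R) *ᵥ y = 0
      · have hRy : R *ᵥ y = y := by
          rw [sub_mulVec, one_mulVec, sub_eq_zero] at h0
          exact h0.symm
        have hWy : W *ᵥ y = y := by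
          rw [hW, sub_mulVec, hRy]
          nth_rewrite 2 [← hRy]
          rw [mulVec_mulVec, Matrix.mul_assoc, hYR]
          simp
        rw [h0, hWy]
        rw [hWy] at hRW
        simpa using localInv_quadForm_pos hc hRW hy
      · have p1 := hM.dotProduct_mulVec_pos h0
        rw [star_trivial] at p1
        by_cases h2 : W *ᵥ y = 0
        · rw [h2]; simpa using p1
        · exact add_pos p1 (localInv_quadForm_pos hc hRW h2)
  · intro i hi j hj
    rw [hinv]
    have h1 : (1 : Matrix V V ℝ) - coordProj (c \ s) = coordProj (c \ s)ᶜ := by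
      rw [sub_eq_iff_eq_add, coordProj_add_of_disjoint disjoint_compl_left,
        Finset.union_comm, Finset.union_compl]
      simp [coordProj]
    have h := glue_inv_old (S := S) (N := M⁻¹) (Y := localInv S s) hRR
    rw [h1] at h
    exact (coordProj_conj_eq_iff _ _ _).1 h i (Finset.mem_compl.2 hi) j (Finset.mem_compl.2 hj)
  · rw [hinv, ← coordProj_conj_eq_iff, ← hER]
    exact glue_inv_new hRR hRs hsR hRN hNR hYR hRY hYE hEY
      (localInv_mul_mul_coordProj hs) hSY ((coordProj_conj_eq_iff s M⁻¹ S).2 hMs)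

end GlueAlgebra

/-! ### Leaf induction over the clique forest -/

section Forest

/-- Take an end of a longest path: a neighbour off the path would lengthen it, and one on the path
must be the second vertex by acyclicity. -/
lemma _root_.SimpleGraph.IsAcyclic.exists_subsingleton_neighborSet {ι : Type*} [Finite ι]
    [Nonempty ι] {T : SimpleGraph ι} (hT : T.IsAcyclic) : ∃ l, (T.neighborSet l).Subsingleton := by
  obtain ⟨u, v, p, hp, hmax⟩ := SimpleGraph.Walk.exists_isPath_forall_isPath_length_le_length T
  refine ⟨u, ?_⟩
  have key : ∀ w, T.Adj u w → w = p.snd := by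
    intro w hadj
    apply hT.eq_snd_of_adj_start hp hadj
    by_contra hw
    have h1 : (p.cons hadj.symm).IsPath := hp.cons hw
    have := hmax _ _ _ h1
    simp at this
  intro a ha b hb
  rw [key a ha, key b hb]

lemma _root_.SimpleGraph.IsAcyclic.exists_leaf {ι : Type*} [Finite ι] {T : SimpleGraph ι}
    (hT : T.IsAcyclic) {A : Finset ι} (hA : A.Nonempty) :
    ∃ l ∈ A, ∀ a ∈ A, ∀ b ∈ A, T.Adj l a → T.Adj l b → a = b := by
  have : Nonempty (A : Set ι) := hA.to_subtype
  obtain ⟨l, hl⟩ := (hT.induce (A : Set ι)).exists_subsingleton_neighborSet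
  refine ⟨l, l.2, fun a ha b hb hla hlb => ?_⟩
  exact congrArg Subtype.val (@hl ⟨a, ha⟩ hla ⟨b, hb⟩ hlb)

/-- A vertex with at most one neighbour is never needed to connect two others. This keeps the
connectivity hypothesis alive when a leaf is removed. -/
lemma preconnected_induce_erase {ι : Type*} {T : SimpleGraph ι} {X : Set ι} {l : ι}
    (hX : (T.induce X).Preconnected) (hl : ∀ a ∈ X, ∀ b ∈ X, T.Adj l a → T.Adj l b → a = b) :
    (T.induce (X \ {l})).Preconnected := by
  have h1 := hX.induce_of_degree_eq_one (s := {i | (i : ι) ≠ l}) (by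
    intro i hi a ha b hb
    have hil : (i : ι) = l := by simpa using hi
    have ha' : T.Adj i a := ha
    have hb' : T.Adj i b := hb
    rw [hil] at ha' hb'
    exact Subtype.ext (hl a a.2 b b.2 ha' hb'))
  refine h1.map (H := T.induce (X \ {l}))
    ⟨fun i => (⟨i.1.1, i.1.2, i.2⟩ : (X \ {l} : Set ι)), fun {a b} h => h⟩ ?_
  rintro ⟨i, hi⟩
  exact ⟨⟨⟨i, hi.1⟩, hi.2⟩, rfl⟩

variable {V ι : Type*} [Fintype V] [DecidableEq V] [Fintype ι] {G : SimpleGraph V}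

open Classical in
/-- The edges of the clique forest between cliques in `A`. -/
def CliqueForest.edgesIn (F : CliqueForest G ι) (A : Finset ι) : Finset (Sym2 ι) :=
  F.T.edgeFinset.filter fun e => ∀ i ∈ e, i ∈ A

/-- The clique-minus-separator sum over the cliques in `A`, completed by the identity. -/
def CliqueForest.partialSum (F : CliqueForest G ι) (S : Matrix V V ℝ) (A : Finset ι) :
    Matrix V V ℝ :=
  coordProj (A.biUnion F.C)ᶜ + ∑ k ∈ A, localInv S (F.C k) -
    ∑ e ∈ F.edgesIn A, localInv S (F.sep e)

lemma CliqueForest.mem_edgesIn (F : CliqueForest G ι) (A : Finset ι) (i j : ι) :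
    s(i, j) ∈ F.edgesIn A ↔ F.T.Adj i j ∧ i ∈ A ∧ j ∈ A := by
  simp [edgesIn]

lemma CliqueForest.sep_mk (F : CliqueForest G ι) (i j : ι) : F.sep s(i, j) = F.C i ∩ F.C j := rfl

lemma localInv_empty (S : Matrix V V ℝ) : localInv S ∅ = 0 := by
  ext i j
  simp [localInv]

/-- The running intersection property of a leaf of the clique forest. -/
lemma CliqueForest.exists_separator [DecidableEq ι] (F : CliqueForest G ι) {A : Finset ι} {l : ι}
    (hlA : l ∉ A)
    (hcon : ∀ v, (F.T.induce {i | i ∈ insert l A ∧ v ∈ F.C i}).Preconnected)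
    (hl : ∀ a ∈ insert l A, ∀ b ∈ insert l A, F.T.Adj l a → F.T.Adj l b → a = b) :
    ∃ s ⊆ F.C l, Disjoint (F.C l \ s) (A.biUnion F.C) ∧ (s = ∅ ∨ ∃ k ∈ A, s ⊆ F.C k) ∧
      ∀ S : Matrix V V ℝ, ∑ e ∈ F.edgesIn (insert l A), localInv S (F.sep e) =
        ∑ e ∈ F.edgesIn A, localInv S (F.sep e) + localInv S s := by
  -- A walk from `l` to `k` through nodes containing v must start with a step to a neighbour of `l`,
  -- so that neighbour contains v as well.
  have key : ∀ v ∈ F.C l, ∀ k ∈ A, v ∈ F.C k → ∃ a ∈ A, F.T.Adj l a ∧ v ∈ F.C a := by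
    intro v hv k hk hvk
    obtain ⟨p⟩ := hcon v ⟨l, Finset.mem_insert_self _ _, hv⟩ ⟨k, Finset.mem_insert_of_mem hk, hvk⟩
    cases p with
    | nil => exact absurd hk hlA
    | @cons _ a _ h p =>
      have hadj : F.T.Adj l a := h
      have ha : (a : ι) ∈ A := by
        rcases Finset.mem_insert.1 a.2.1 with h1 | h1
        · exact absurd h1.symm hadj.ne
        · exact h1
      exact ⟨a, ha, hadj, a.2.2⟩
  by_cases hex : ∃ a ∈ A, F.T.Adj l a
  · obtain ⟨a, ha, hadj⟩ := hex
    refine ⟨F.C l ∩ F.C a, Finset.inter_subset_left, ?_, Or.inr ⟨a, ha, Finset.inter_subset_right⟩,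
      ?_⟩
    · rw [Finset.disjoint_left]
      intro v hv hvU
      obtain ⟨k, hk, hvk⟩ := Finset.mem_biUnion.1 hvU
      obtain ⟨hvl, hvn⟩ := Finset.mem_sdiff.1 hv
      obtain ⟨b, hb, hadj', hvb⟩ := key v hvl k hk hvk
      have := hl a (Finset.mem_insert_of_mem ha) b (Finset.mem_insert_of_mem hb) hadj hadj'
      subst this
      exact hvn (Finset.mem_inter.2 ⟨hvl, hvb⟩)
    · intro S
      have hins : F.edgesIn (insert l A) = insert s(l, a) (F.edgesIn A) := by
        ext e
        induction e using Sym2.ind with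
        | _ i j =>
        rw [F.mem_edgesIn, Finset.mem_insert (a := s(i, j)), F.mem_edgesIn]
        constructor
        · rintro ⟨hij, hi, hj⟩
          rcases Finset.mem_insert.1 hi with rfl | hi'
          · left
            rw [hl a (Finset.mem_insert_of_mem ha) j hj hadj hij]
          · rcases Finset.mem_insert.1 hj with rfl | hj'
            · left
              rw [hl a (Finset.mem_insert_of_mem ha) i hi hadj hij.symm, Sym2.eq_swap]
            · exact Or.inr ⟨hij, hi', hj'⟩
        · rintro (h | ⟨hij, hi, hj⟩)
          · rcases Sym2.eq_iff.1 h with ⟨rfl, rfl⟩ | ⟨rfl, rfl⟩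
            · exact ⟨hadj, Finset.mem_insert_self _ _, Finset.mem_insert_of_mem ha⟩
            · exact ⟨hadj.symm, Finset.mem_insert_of_mem ha, Finset.mem_insert_self _ _⟩
          · exact ⟨hij, Finset.mem_insert_of_mem hi, Finset.mem_insert_of_mem hj⟩
      rw [hins, Finset.sum_insert, add_comm, F.sep_mk]
      rw [F.mem_edgesIn]
      exact fun h => hlA h.2.1
  · refine ⟨∅, Finset.empty_subset _, ?_, Or.inl rfl, ?_⟩
    · rw [Finset.disjoint_left]
      intro v hv hvU
      obtain ⟨k, hk, hvk⟩ := Finset.mem_biUnion.1 hvU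
      obtain ⟨b, hb, hadj', -⟩ := key v (Finset.mem_sdiff.1 hv).1 k hk hvk
      exact hex ⟨b, hb, hadj'⟩
    · intro S
      rw [localInv_empty, add_zero]
      congr 1
      ext e
      induction e using Sym2.ind with
      | _ i j =>
      rw [F.mem_edgesIn, F.mem_edgesIn]
      constructor
      · rintro ⟨hij, hi, hj⟩
        rcases Finset.mem_insert.1 hi with rfl | hi'
        · rcases Finset.mem_insert.1 hj with rfl | hj'
          · exact absurd rfl hij.ne
          · exact absurd ⟨j, hj', hij⟩ hex
        · rcases Finset.mem_insert.1 hj with rfl | hj'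
          · exact absurd ⟨i, hi', hij.symm⟩ hex
          · exact ⟨hij, hi', hj'⟩
      · rintro ⟨hij, hi, hj⟩
        exact ⟨hij, Finset.mem_insert_of_mem hi, Finset.mem_insert_of_mem hj⟩

lemma CliqueForest.partialSum_mul_coordProj (F : CliqueForest G ι) (S : Matrix V V ℝ)
    {A : Finset ι} {R : Finset V} (hR : Disjoint R (A.biUnion F.C)) :
    F.partialSum S A * coordProj R = coordProj R := by
  have hk : ∀ k ∈ A, Disjoint (F.C k) R := fun k hk =>
    (hR.mono_right (Finset.subset_biUnion_of_mem F.C hk)).symm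
  rw [partialSum, Matrix.sub_mul, Matrix.add_mul, Matrix.sum_mul, Matrix.sum_mul,
    Finset.sum_eq_zero, Finset.sum_eq_zero, coordProj_mul_of_superset]
  · simp
  · intro v hv
    exact Finset.mem_compl.2 (Finset.disjoint_left.1 hR hv)
  · intro e he
    induction e using Sym2.ind with
    | _ i j =>
    rw [F.mem_edgesIn] at he
    exact localInv_mul_coordProj_eq_zero S
      ((hk i he.2.1).mono_left (by rw [F.sep_mk]; exact Finset.inter_subset_left))
  · intro k hkA
    exact localInv_mul_coordProj_eq_zero S (hk k hkA)

/-- Induction on the number of cliques, removing a leaf of the forest induced on `A`. Connectivity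
is required only inside `A`, so that the hypothesis passes to the smaller family; the identity on
uncovered vertices makes every partial sum a full V × V precision matrix, starting from 1. -/
theorem CliqueForest.partialSum_posDef (F : CliqueForest G ι) {S : Matrix V V ℝ} (hS : S.IsSymm)
    (hpd : ∀ k, (block S (F.C k)).PosDef) :
    ∀ (n : ℕ) (A : Finset ι), A.card = n →
      (∀ v, (F.T.induce {i | i ∈ A ∧ v ∈ F.C i}).Preconnected) →
      (F.partialSum S A).PosDef ∧
        ∀ k ∈ A, ∀ i ∈ F.C k, ∀ j ∈ F.C k, (F.partialSum S A)⁻¹ i j = S i j := by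
  classical
  intro n
  induction n with
  | zero =>
    intro A hA _
    rw [Finset.card_eq_zero] at hA
    subst hA
    have : F.partialSum S ∅ = 1 := by
      have : F.edgesIn ∅ = ∅ := by
        ext e
        induction e using Sym2.ind with
        | _ i j => simp [F.mem_edgesIn]
      rw [partialSum, this]
      simp [coordProj]
    rw [this]
    exact ⟨PosDef.one, by simp⟩
  | succ n ih =>
    intro A hA hcon
    have hne : A.Nonempty := Finset.card_pos.1 (by omega)
    obtain ⟨l, hlA, hl⟩ := F.acyclic.exists_leaf hne
    obtain ⟨B, hlB, rfl⟩ : ∃ B, l ∉ B ∧ insert l B = A :=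
      ⟨A.erase l, Finset.notMem_erase _ _, Finset.insert_erase hlA⟩
    have hBcard : B.card = n := by
      rw [Finset.card_insert_of_notMem hlB] at hA; omega
    have hBcon : ∀ v, (F.T.induce {i | i ∈ B ∧ v ∈ F.C i}).Preconnected := by
      intro v
      have h := preconnected_induce_erase (hcon v)
        (l := l) (fun a ha b hb => hl a ha.1 b hb.1)
      have hset : {i | i ∈ insert l B ∧ v ∈ F.C i} \ {l} = {i | i ∈ B ∧ v ∈ F.C i} := by
        ext i
        simp only [Set.mem_sdiff, Set.mem_ofPred_eq, Finset.mem_insert, Set.mem_singleton_iff]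
        constructor
        · rintro ⟨⟨h1 | h1, h2⟩, h3⟩
          · exact absurd h1 h3
          · exact ⟨h1, h2⟩
        · rintro ⟨h1, h2⟩
          exact ⟨⟨Or.inr h1, h2⟩, fun h => hlB (h ▸ h1)⟩
      rwa [hset] at h
    obtain ⟨ihP, ihI⟩ := ih B hBcard hBcon
    obtain ⟨s, hsl, hdis, hsB, hsum⟩ := F.exists_separator hlB hcon hl
    have hs : ∀ i ∈ s, ∀ j ∈ s, (F.partialSum S B)⁻¹ i j = S i j := by
      rcases hsB with rfl | ⟨k, hk, hsk⟩
      · simp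
      · exact fun i hi j hj => ihI k hk i (hsk hi) j (hsk hj)
    have heq : F.partialSum S (insert l B) =
        F.partialSum S B - coordProj (F.C l \ s) + localInv S (F.C l) - localInv S s := by
      -- The vertices of the leaf outside its separator are new, so they leave the identity part;
      -- this is the term -R of the gluing step.
      have h1 : coordProj (B.biUnion F.C)ᶜ =
          coordProj ((insert l B).biUnion F.C)ᶜ + coordProj (F.C l \ s) := by
        rw [coordProj_add_of_disjoint]
        · congr 1
          ext v
          have hv : v ∈ F.C l \ s → v ∉ B.biUnion F.C := fun h => Finset.disjoint_left.1 hdis h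
          rcases hsB with rfl | ⟨k, hk, hsk⟩
          · simp only [Finset.mem_compl, Finset.biUnion_insert, Finset.mem_union, Finset.mem_sdiff,
              Finset.notMem_empty, not_false_eq_true, and_true] at hv ⊢
            tauto
          · have hvs : v ∈ s → v ∈ B.biUnion F.C := fun h =>
              Finset.mem_biUnion.2 ⟨k, hk, hsk h⟩
            simp only [Finset.mem_compl, Finset.biUnion_insert, Finset.mem_union,
              Finset.mem_sdiff] at hv ⊢
            tauto
        · rw [Finset.disjoint_left]
          intro v hv hv'
          refine Finset.mem_compl.1 hv ?_
          rw [Finset.biUnion_insert]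
          exact Finset.mem_union_left _ (Finset.mem_sdiff.1 hv').1
      rw [partialSum, partialSum, hsum, Finset.sum_insert hlB, h1]
      abel
    rw [heq]
    obtain ⟨g1, g2, g3⟩ := glue_clique hS hsl (hpd l) ihP
      (F.partialSum_mul_coordProj S hdis) hs
    refine ⟨g1, fun k hk i hi j hj => ?_⟩
    rcases Finset.mem_insert.1 hk with rfl | hk
    · exact g3 i hi j hj
    · have hnot : ∀ v ∈ F.C k, v ∉ F.C l \ s := fun v hv hv' =>
        Finset.disjoint_left.1 hdis hv' (Finset.mem_biUnion.2 ⟨k, hk, hv⟩)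
      rw [g2 i (hnot i hi) j (hnot j hj)]
      exact ihI k hk i hi j hj

lemma CliqueForest.exists_mem (F : CliqueForest G ι) (v : V) : ∃ k, v ∈ F.C k := by
  obtain ⟨⟨k, hk⟩⟩ := (F.connected v).nonempty
  exact ⟨k, hk⟩

lemma CliqueForest.common_iff (F : CliqueForest G ι) (i j : V) :
    (∃ k, i ∈ F.C k ∧ j ∈ F.C k) ↔ i = j ∨ G.Adj i j := by
  constructor
  · intro h
    by_cases hij : i = j
    · exact Or.inl hij
    · exact Or.inr ((F.adj_iff i j).2 ⟨hij, h⟩)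
  · rintro (rfl | h)
    · obtain ⟨k, hk⟩ := F.exists_mem i
      exact ⟨k, hk, hk⟩
    · exact ((F.adj_iff i j).1 h).2

lemma CliqueForest.cliqueMinusSep_eq_partialSum (F : CliqueForest G ι) (S : Matrix V V ℝ) :
    cliqueMinusSep F S = F.partialSum S Finset.univ := by
  have hU : (Finset.univ.biUnion F.C)ᶜ = ∅ := by
    ext v
    obtain ⟨k, hk⟩ := F.exists_mem v
    simpa using ⟨k, hk⟩
  ext i j
  rw [partialSum, hU]
  simp [cliqueMinusSep, edgesIn, coordProj, Matrix.sum_apply]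

lemma CliqueForest.cliqueMinusSep_eq_zero (F : CliqueForest G ι) (S : Matrix V V ℝ) {i j : V}
    (h : ¬ ∃ k, i ∈ F.C k ∧ j ∈ F.C k) : cliqueMinusSep F S i j = 0 := by
  rw [cliqueMinusSep, Finset.sum_eq_zero, Finset.sum_eq_zero, sub_zero]
  · intro e _
    induction e using Sym2.ind with
    | _ a b =>
    rw [localInv, dif_neg]
    rw [F.sep_mk]
    exact fun hh => h ⟨a, (Finset.mem_inter.1 hh.1).1, (Finset.mem_inter.1 hh.2).1⟩
  · intro k _
    rw [localInv, dif_neg]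
    exact fun hh => h ⟨k, hh⟩

/-- If the clique blocks of a symmetric matrix `S` are positive definite, then the
clique-minus-separator sum is positive definite, and its inverse completes `S`. -/
theorem CliqueForest.cliqueMinusSep_posDef (F : CliqueForest G ι) {S : Matrix V V ℝ}
    (hS : S.IsSymm) (hpd : ∀ k, (block S (F.C k)).PosDef) :
    (cliqueMinusSep F S).PosDef ∧
      ∀ i j, (∃ k, i ∈ F.C k ∧ j ∈ F.C k) → (cliqueMinusSep F S)⁻¹ i j = S i j := by
  have h := F.partialSum_posDef hS hpd _ Finset.univ rfl (fun v => by
    have hset : {i | i ∈ (Finset.univ : Finset ι) ∧ v ∈ F.C i} = {i | v ∈ F.C i} := by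
      ext i; simp
    rw [hset]
    exact (F.connected v).preconnected)
  rw [← F.cliqueMinusSep_eq_partialSum] at h
  exact ⟨h.1, fun i j ⟨k, hi, hj⟩ => h.2 k (Finset.mem_univ k) i hi j hj⟩

lemma CliqueForest.sep_posDef (F : CliqueForest G ι) {S : Matrix V V ℝ}
    (hpd : ∀ k, (block S (F.C k)).PosDef) (e : Sym2 ι) : (block S (F.sep e)).PosDef := by
  induction e using Sym2.ind with
  | _ a b => exact block_posDef_of_subset (by rw [F.sep_mk]; exact Finset.inter_subset_left) (hpd a)

end Forest

/-! ### Concavity and derivative of log det -/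

section LogDet

variable {V : Type*} [Fintype V] [DecidableEq V]

lemma exists_isUnit_transpose_mul_self {A : Matrix V V ℝ} (hA : A.PosDef) :
    ∃ B : Matrix V V ℝ, A = Bᵀ * B ∧ IsUnit B := by
  open scoped MatrixOrder in
  obtain ⟨B, hB⟩ := CStarAlgebra.nonneg_iff_eq_star_mul_self.mp hA.posSemidef.nonneg
  rw [star_eq_conjTranspose, conjTranspose_eq_transpose_of_trivial] at hB
  refine ⟨B, hB, ?_⟩
  have h := hA.isUnit
  rw [isUnit_iff_isUnit_det] at h ⊢
  rw [hB, det_mul] at h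
  exact isUnit_of_mul_isUnit_right h

lemma log_det_le_trace_sub_card {A : Matrix V V ℝ} (hA : A.PosDef) :
    Real.log A.det ≤ A.trace - Fintype.card V := by
  rw [hA.isHermitian.det_eq_prod_eigenvalues, hA.isHermitian.trace_eq_sum_eigenvalues]
  simp only [RCLike.ofReal_real_eq_id, id]
  rw [Real.log_prod (fun i _ => (hA.eigenvalues_pos i).ne')]
  calc ∑ i, Real.log (hA.isHermitian.eigenvalues i)
      ≤ ∑ i, (hA.isHermitian.eigenvalues i - 1) :=
        Finset.sum_le_sum fun i _ => Real.log_le_sub_one_of_pos (hA.eigenvalues_pos i)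
    _ = _ := by simp [Finset.sum_sub_distrib]

/-- The tangent inequality of the concave function log det at J. Writing J⁻¹ = Bᵀ B reduces it to B
K Bᵀ, whose eigenvalues satisfy log λ ≤ λ - 1. -/
lemma log_det_le_add_trace {J K : Matrix V V ℝ} (hJ : J.PosDef) (hK : K.PosDef) :
    Real.log K.det ≤ Real.log J.det + (J⁻¹ * (K - J)).trace := by
  obtain ⟨B, hB, hBu⟩ := exists_isUnit_transpose_mul_self hJ.inv
  have hJu : IsUnit J.det := (isUnit_iff_isUnit_det _).1 hJ.isUnit
  have hA : (B * K * Bᵀ).PosDef := by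
    have := hK.mul_mul_conjTranspose_same (B := B) (vecMul_injective_of_isUnit hBu)
    rwa [conjTranspose_eq_transpose_of_trivial] at this
  have h := log_det_le_trace_sub_card hA
  have hdet : (B * K * Bᵀ).det = J.det⁻¹ * K.det := by
    have h1 : J⁻¹.det = J.det⁻¹ := by rw [det_nonsing_inv, Ring.inverse_eq_inv']
    rw [← h1, hB, det_mul, det_mul, det_mul]; ring
  have htr : (B * K * Bᵀ).trace = (J⁻¹ * K).trace := by
    rw [hB, trace_mul_comm, ← Matrix.mul_assoc]
  rw [hdet, htr, Real.log_mul (inv_ne_zero hJ.det_pos.ne') hK.det_pos.ne', Real.log_inv] at h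
  rw [Matrix.mul_sub, nonsing_inv_mul _ hJu, trace_sub, trace_one]
  linarith

/-- Strict monotonicity of inversion: with J⁻¹ = Bᵀ B and K⁻¹ = Cᵀ C, the trace is minus the squared
Frobenius norm of B (J - K) Cᵀ. -/
lemma eq_of_trace_mul_inv_sub_inv {J K : Matrix V V ℝ} (hJ : J.PosDef) (hK : K.PosDef)
    (h : ((J - K) * (J⁻¹ - K⁻¹)).trace = 0) : J = K := by
  obtain ⟨B, hB, hBu⟩ := exists_isUnit_transpose_mul_self hJ.inv
  obtain ⟨C, hC, hCu⟩ := exists_isUnit_transpose_mul_self hK.inv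
  have hJu : IsUnit J.det := (isUnit_iff_isUnit_det _).1 hJ.isUnit
  have hKu : IsUnit K.det := (isUnit_iff_isUnit_det _).1 hK.isUnit
  have hDT : (J - K)ᵀ = J - K := by
    have h1 : Jᵀ = J := by simpa using hJ.isHermitian.eq
    have h2 : Kᵀ = K := by simpa using hK.isHermitian.eq
    rw [transpose_sub, h1, h2]
  have e1 : J⁻¹ - K⁻¹ = -(J⁻¹ * (J - K) * K⁻¹) := by
    rw [Matrix.mul_sub, Matrix.sub_mul, nonsing_inv_mul _ hJu, Matrix.mul_assoc,
      mul_nonsing_inv _ hKu]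
    simp
  have e2 : ((B * (J - K) * Cᵀ)ᴴ * (B * (J - K) * Cᵀ)).trace = 0 := by
    rw [conjTranspose_eq_transpose_of_trivial, transpose_mul, transpose_mul, transpose_transpose,
      hDT]
    have : (C * ((J - K) * Bᵀ) * (B * (J - K) * Cᵀ)).trace =
        ((J - K) * (Bᵀ * B * (J - K) * (Cᵀ * C))).trace := by
      rw [Matrix.mul_assoc, trace_mul_comm]
      simp only [Matrix.mul_assoc]
    rw [this, ← hB, ← hC]
    rw [e1, Matrix.mul_neg, trace_neg, neg_eq_zero] at h
    exact h
  rw [trace_conjTranspose_mul_self_eq_zero_iff] at e2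
  have e3 : J - K = 0 := by
    have h1 : B * ((J - K) * Cᵀ) = B * 0 := by rw [← Matrix.mul_assoc, e2, Matrix.mul_zero]
    have h2 := hBu.mul_left_cancel h1
    have hCu' : IsUnit Cᵀ := by
      rw [isUnit_iff_isUnit_det] at hCu ⊢
      rwa [det_transpose]
    exact hCu'.mul_right_cancel (b := Cᵀ) (by rw [h2, Matrix.zero_mul])
  exact sub_eq_zero.1 e3

/-- The determinant is 1 + t tr M plus t² times a polynomial in t, so only the linear term
contributes at 0. -/
lemma hasDerivAt_det_one_add_smul (M : Matrix V V ℝ) :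
    HasDerivAt (fun t : ℝ => (1 + t • M).det) M.trace 0 := by
  have h1 : (fun t : ℝ => (1 + t • M).det) = fun t : ℝ => 1 + M.trace * t +
      (det (1 + (Polynomial.X : Polynomial ℝ) • M.map Polynomial.C)).divX.divX.eval t * t ^ 2 :=
    funext fun t => det_one_add_smul t M
  rw [h1]
  have h2 := (((hasDerivAt_id (0 : ℝ)).const_mul M.trace).const_add 1).add
    (((det (1 + (Polynomial.X : Polynomial ℝ) • M.map Polynomial.C)).divX.divX.hasDerivAt
      (0 : ℝ)).mul ((hasDerivAt_id (0 : ℝ)).pow 2))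
  refine HasDerivAt.congr_deriv h2 ?_
  simp

lemma hasDerivAt_log_det {J : Matrix V V ℝ} (hJ : J.PosDef) (H : Matrix V V ℝ) :
    HasDerivAt (fun t : ℝ => Real.log (J + t • H).det) (J⁻¹ * H).trace 0 := by
  have hJu : IsUnit J.det := (isUnit_iff_isUnit_det _).1 hJ.isUnit
  have h1 : (fun t : ℝ => (J + t • H).det) = fun t : ℝ => J.det * (1 + t • (J⁻¹ * H)).det := by
    funext t
    rw [← det_mul, Matrix.mul_add, Matrix.mul_one, Matrix.mul_smul, ← Matrix.mul_assoc,
      mul_nonsing_inv _ hJu, Matrix.one_mul]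
  have h2 : HasDerivAt (fun t : ℝ => (J + t • H).det) (J.det * (J⁻¹ * H).trace) 0 := by
    rw [h1]
    exact (hasDerivAt_det_one_add_smul _).const_mul _
  have h3 := h2.log (by simpa using hJ.det_pos.ne')
  refine h3.congr_deriv ?_
  simp only [zero_smul, add_zero]
  field_simp [hJ.det_pos.ne']

/-- The quadratic form is positive on the compact unit sphere, hence stays positive there for small
t; homogeneity gives all nonzero vectors. -/
lemma eventually_posDef_add_smul {J H : Matrix V V ℝ} (hJ : J.PosDef) (hH : H.IsSymm) :
    ∀ᶠ t : ℝ in 𝓝 0, (J + t • H).PosDef := by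
  have hK : IsCompact (Metric.sphere (0 : V → ℝ) 1) := isCompact_sphere _ _
  have hcont : Continuous fun z : ℝ × (V → ℝ) => z.2 ⬝ᵥ ((J + z.1 • H) *ᵥ z.2) := by
    fun_prop
  have h := hK.eventually_forall_of_forall_eventually (x₀ := (0 : ℝ))
    (P := fun t y => 0 < y ⬝ᵥ ((J + t • H) *ᵥ y)) (by
      intro y hy
      have hy0 : y ≠ 0 := by
        rintro rfl
        simp at hy
      refine hcont.continuousAt.eventually (lt_mem_nhds ?_)
      simpa using hJ.dotProduct_mulVec_pos hy0)
  filter_upwards [h] with t ht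
  refine PosDef.of_dotProduct_mulVec_pos ?_ ?_
  · have h1 : Jᵀ = J := by simpa using hJ.isHermitian.eq
    simp only [IsHermitian, conjTranspose_eq_transpose_of_trivial, transpose_add, transpose_smul,
      h1, hH.eq]
  · intro y hy
    have hn : 0 < ‖y‖ := norm_pos_iff.2 hy
    have h1 := ht (‖y‖⁻¹ • y) (by simp [norm_smul, hn.ne'])
    rw [mulVec_smul, dotProduct_smul, smul_dotProduct, smul_eq_mul, smul_eq_mul] at h1
    rw [star_trivial]
    have h2 : 0 < ‖y‖⁻¹ := inv_pos.2 hn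
    exact (mul_pos_iff_of_pos_left h2).1 ((mul_pos_iff_of_pos_left h2).1 h1)

end LogDet

/-! ### The Gaussian objective under the sparsity constraint -/

section Precision

variable {V ι : Type*} [Fintype V] [DecidableEq V] [Fintype ι] {G : SimpleGraph V}

/-- The admissible inverse covariances. -/
def precisions (G : SimpleGraph V) : Set (Matrix V V ℝ) :=
  {J | J.PosDef ∧ ∀ i j, i ≠ j → ¬ G.Adj i j → J i j = 0}

/-- Two matrices agree on the diagonal and on the edges of `G`. -/
def AgreeOn (G : SimpleGraph V) (A B : Matrix V V ℝ) : Prop :=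
  ∀ i j, i = j ∨ G.Adj i j → A i j = B i j

lemma trace_mul_eq_of_agreeOn {A B D : Matrix V V ℝ} (h : AgreeOn G A B)
    (hD : ∀ i j, i ≠ j → ¬ G.Adj i j → D i j = 0) : (A * D).trace = (B * D).trace := by
  simp only [trace, diag_apply, mul_apply]
  refine Finset.sum_congr rfl fun i _ => Finset.sum_congr rfl fun j _ => ?_
  by_cases hij : i = j ∨ G.Adj i j
  · rw [h i j hij]
  · push Not at hij
    rw [hD j i (Ne.symm hij.1) (fun h => hij.2 h.symm), mul_zero, mul_zero]

/-- J - K vanishes off the edges and J⁻¹ - K⁻¹ vanishes on the diagonal and the edges, so the trace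
of their product is 0. -/
lemma eq_of_agreeOn_inv {J K : Matrix V V ℝ} (hJ : J ∈ precisions G) (hK : K ∈ precisions G)
    (h : AgreeOn G J⁻¹ K⁻¹) : J = K := by
  refine eq_of_trace_mul_inv_sub_inv hJ.1 hK.1 ?_
  rw [trace_mul_comm, Matrix.sub_mul, trace_sub, sub_eq_zero]
  refine trace_mul_eq_of_agreeOn h fun i j h1 h2 => ?_
  rw [Matrix.sub_apply, hJ.2 i j h1 h2, hK.2 i j h1 h2, sub_zero]

/-- The Gaussian objective. -/
def gaussObj (S J : Matrix V V ℝ) : ℝ := Real.log J.det - (S * J).trace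

/-- In the tangent inequality at J the increment K - J sees only the positions where J⁻¹ and S
coincide, so the linear term equals tr(S(K - J)). -/
lemma gaussObj_le_of_agreeOn {S J K : Matrix V V ℝ} (hJ : J ∈ precisions G)
    (hK : K ∈ precisions G) (h : AgreeOn G J⁻¹ S) : gaussObj S K ≤ gaussObj S J := by
  have h1 := log_det_le_add_trace hJ.1 hK.1
  rw [trace_mul_eq_of_agreeOn h (fun i j h1 h2 => by
    rw [Matrix.sub_apply, hJ.2 i j h1 h2, hK.2 i j h1 h2, sub_zero]), Matrix.mul_sub,
    trace_sub] at h1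
  unfold gaussObj
  linarith

lemma hasDerivAt_gaussObj {J : Matrix V V ℝ} (hJ : J.PosDef) (S H : Matrix V V ℝ) :
    HasDerivAt (fun t : ℝ => gaussObj S (J + t • H)) ((J⁻¹ * H).trace - (S * H).trace) 0 := by
  unfold gaussObj
  refine (hasDerivAt_log_det hJ H).sub ?_
  simp only [Matrix.mul_add, trace_add, Matrix.mul_smul, trace_smul, smul_eq_mul]
  simpa using ((hasDerivAt_id (0 : ℝ)).mul_const (S * H).trace).const_add (S * J).trace

lemma agreeOn_of_trace_mul_eq {A B : Matrix V V ℝ} (hA : A.IsSymm) (hB : B.IsSymm)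
    (h : ∀ H : Matrix V V ℝ, H.IsSymm → (∀ i j, i ≠ j → ¬ G.Adj i j → H i j = 0) →
      (A * H).trace = (B * H).trace) : AgreeOn G A B := by
  intro i j hij
  -- The symmetric test direction also covers i = j, where it is twice the diagonal unit; in either
  -- case the trace is twice the entry.
  have h1 := h (Matrix.single i j 1 + Matrix.single j i 1) (by
      rw [IsSymm, transpose_add, transpose_single, transpose_single, add_comm]) (by
      intro a b hab hadj
      have h2 : ¬ (i = a ∧ j = b) := by
        rintro ⟨rfl, rfl⟩
        rcases hij with h | h
        · exact hab h
        · exact hadj h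
      have h3 : ¬ (j = a ∧ i = b) := by
        rintro ⟨rfl, rfl⟩
        rcases hij with h | h
        · exact hab h.symm
        · exact hadj h.symm
      rw [Matrix.add_apply, single_apply_of_ne _ _ _ _ _ h2,
        single_apply_of_ne _ _ _ _ _ h3, add_zero])
  have h2 : ∀ C : Matrix V V ℝ, C.IsSymm →
      (C * (Matrix.single i j 1 + Matrix.single j i 1)).trace = 2 * C i j := by
    intro C hC
    rw [Matrix.mul_add, trace_add, trace_mul_single, trace_mul_single]
    have := hC.apply i j
    simp [this]; ring
  rw [h2 A hA, h2 B hB] at h1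
  linarith

lemma isSymm_inv {J : Matrix V V ℝ} (hJ : J.PosDef) : J⁻¹.IsSymm := by
  have := hJ.inv.isHermitian.eq
  rwa [conjTranspose_eq_transpose_of_trivial] at this

/-- The first-order condition at a maximizer: every admissible symmetric direction stays in the
positive definite cone for small t. S itself need not be positive definite. -/
lemma agreeOn_of_gaussObj_le {S J : Matrix V V ℝ} (hS : S.IsSymm) (hJ : J ∈ precisions G)
    (h : ∀ K ∈ precisions G, gaussObj S K ≤ gaussObj S J) : AgreeOn G J⁻¹ S := by
  refine agreeOn_of_trace_mul_eq (isSymm_inv hJ.1) hS fun H hH hH0 => ?_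
  have hmax : IsLocalMax (fun t : ℝ => gaussObj S (J + t • H)) 0 := by
    filter_upwards [eventually_posDef_add_smul hJ.1 hH] with t ht
    simp only [zero_smul, add_zero]
    refine h _ ⟨ht, fun i j h1 h2 => ?_⟩
    simp [hJ.2 i j h1 h2, hH0 i j h1 h2]
  exact sub_eq_zero.1 (hmax.hasDerivAt_eq_zero (hasDerivAt_gaussObj hJ.1 S H))

lemma CliqueForest.agreeOn_iff (F : CliqueForest G ι) {A B : Matrix V V ℝ} :
    AgreeOn G A B ↔ ∀ i j, (∃ k, i ∈ F.C k ∧ j ∈ F.C k) → A i j = B i j := by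
  simp only [AgreeOn, F.common_iff]

lemma CliqueForest.cliqueMinusSep_mem_precisions (F : CliqueForest G ι) {S : Matrix V V ℝ}
    (hS : S.IsSymm) (hpd : ∀ k, (block S (F.C k)).PosDef) :
    cliqueMinusSep F S ∈ precisions G :=
  ⟨(F.cliqueMinusSep_posDef hS hpd).1, fun i j h1 h2 => F.cliqueMinusSep_eq_zero S (by
    rw [F.common_iff]
    exact fun h => h.elim h1 h2)⟩

lemma CliqueForest.agreeOn_cliqueMinusSep (F : CliqueForest G ι) {S : Matrix V V ℝ}
    (hS : S.IsSymm) (hpd : ∀ k, (block S (F.C k)).PosDef) :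
    AgreeOn G (cliqueMinusSep F S)⁻¹ S :=
  F.agreeOn_iff.2 (F.cliqueMinusSep_posDef hS hpd).2

/-- The clique blocks of S are principal blocks of the positive definite J⁻¹. Hence the mere
existence of a fixed point or an update supplies the positivity needed for the closed form. -/
lemma CliqueForest.block_posDef_of_agreeOn (F : CliqueForest G ι) {S J : Matrix V V ℝ}
    (hJ : J ∈ precisions G) (h : AgreeOn G J⁻¹ S) (k : ι) : (block S (F.C k)).PosDef := by
  have h1 : block S (F.C k) = block J⁻¹ (F.C k) := by
    ext i j
    exact ((F.agreeOn_iff.1 h) i j ⟨k, i.2, j.2⟩).symm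
  rw [h1]
  exact hJ.1.inv.submatrix Subtype.val_injective

lemma CliqueForest.eq_cliqueMinusSep_of_agreeOn (F : CliqueForest G ι) {S J : Matrix V V ℝ}
    (hS : S.IsSymm) (hJ : J ∈ precisions G) (h : AgreeOn G J⁻¹ S) : J = cliqueMinusSep F S := by
  have hpd := F.block_posDef_of_agreeOn hJ h
  refine eq_of_agreeOn_inv hJ (F.cliqueMinusSep_mem_precisions hS hpd) fun i j hij => ?_
  rw [h i j hij, F.agreeOn_cliqueMinusSep hS hpd i j hij]

lemma continuousAt_localInv {S : Matrix V V ℝ} {c : Finset V} (h : (block S c).PosDef) (i j : V) :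
    ContinuousAt (fun A : Matrix V V ℝ => localInv A c i j) S := by
  unfold localInv
  by_cases hij : i ∈ c ∧ j ∈ c
  · simp only [dif_pos hij]
    have h1 : ContinuousAt (fun A : Matrix V V ℝ => (block A c)⁻¹) S := by
      refine ContinuousAt.comp (g := Inv.inv) (continuousAt_matrix_inv _ ?_) ?_
      · rw [Ring.inverse_eq_inv']
        exact continuousAt_inv₀ h.det_pos.ne'
      · exact (continuous_id.matrix_submatrix _ _).continuousAt
    exact ((continuous_id.matrix_elem _ _).continuousAt).comp h1
  · simp only [dif_neg hij]
    exact continuousAt_const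

lemma CliqueForest.continuousAt_cliqueMinusSep (F : CliqueForest G ι) {S : Matrix V V ℝ}
    (hpd : ∀ k, (block S (F.C k)).PosDef) : ContinuousAt (cliqueMinusSep F) S := by
  refine continuousAt_pi.2 fun i => continuousAt_pi.2 fun j => ?_
  unfold cliqueMinusSep
  refine ContinuousAt.sub ?_ ?_
  · exact tendsto_finsetSum _ fun k _ => continuousAt_localInv (hpd k) i j
  · exact tendsto_finsetSum _ fun e _ => continuousAt_localInv (F.sep_posDef hpd e) i j

end Precision

/-! ### Integrals against the Gamma kernel -/

section GammaIntegrals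

lemma integrableOn_gammaKernel {a r : ℝ} (ha : 0 < a) (hr : 0 < r) :
    IntegrableOn (fun z : ℝ => z ^ (a - 1) * Real.exp (-(r * z))) (Set.Ioi 0) := by
  have h := integrableOn_rpow_mul_exp_neg_mul_rpow (p := 1) (s := a - 1) (b := r)
    (by linarith) one_pos hr
  simpa only [Real.rpow_one, neg_mul] using h

lemma integrableOn_mul_gammaKernel {a r : ℝ} (ha : 0 < a) (hr : 0 < r) :
    IntegrableOn (fun z : ℝ => z * (z ^ (a - 1) * Real.exp (-(r * z)))) (Set.Ioi 0) := by
  refine (integrableOn_gammaKernel (a := a + 1) (by linarith) hr).congr_fun (fun z hz => ?_)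
    measurableSet_Ioi
  have hz' : (0 : ℝ) < z := hz
  have : z ^ (a + 1 - 1) = z * z ^ (a - 1) := by
    rw [show a + 1 - 1 = 1 + (a - 1) by ring, Real.rpow_add hz', Real.rpow_one]
  simp only [this, mul_assoc]

lemma integral_mul_gammaKernel {a r : ℝ} (ha : 0 < a) (hr : 0 < r) :
    ∫ z in Set.Ioi (0 : ℝ), z * (z ^ (a - 1) * Real.exp (-(r * z))) =
      a / r * ((1 / r) ^ a * Real.Gamma a) := by
  have h : ∫ z in Set.Ioi (0 : ℝ), z * (z ^ (a - 1) * Real.exp (-(r * z))) =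
      ∫ z in Set.Ioi (0 : ℝ), z ^ (a + 1 - 1) * Real.exp (-(r * z)) := by
    refine setIntegral_congr_fun measurableSet_Ioi fun z hz => ?_
    have hz' : (0 : ℝ) < z := hz
    have : z ^ (a + 1 - 1) = z * z ^ (a - 1) := by
      rw [show a + 1 - 1 = 1 + (a - 1) by ring, Real.rpow_add hz', Real.rpow_one]
    simp only [this, mul_assoc]
  rw [h, Real.integral_rpow_mul_exp_neg_mul_Ioi (by linarith) hr, Real.Gamma_add_one ha.ne',
    Real.rpow_add (by positivity), Real.rpow_one]
  ring

/-- The bound |log z| ≤ z + 1/z dominates the integrand by kernels of shapes a + 1 and a - 1; the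
latter is why a > 1 is assumed. In the application a = (ν + p)/2, and ν > 2 suffices. -/
lemma integrableOn_log_mul_gammaKernel {a r : ℝ} (ha : 1 < a) (hr : 0 < r) :
    IntegrableOn (fun z : ℝ => Real.log z * (z ^ (a - 1) * Real.exp (-(r * z)))) (Set.Ioi 0) := by
  have h1 := integrableOn_mul_gammaKernel (a := a) (by linarith) hr
  have h2 := integrableOn_gammaKernel (a := a - 1) (by linarith) hr
  refine Integrable.mono' (h1.add h2) ?_ ?_
  · refine Measurable.aestronglyMeasurable ?_
    exact Real.measurable_log.mul (by fun_prop)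
  · refine (ae_restrict_iff' measurableSet_Ioi).2 (Eventually.of_forall fun z hz => ?_)
    have hz' : (0 : ℝ) < z := hz
    have hk : 0 ≤ z ^ (a - 1) * Real.exp (-(r * z)) := by positivity
    have hpow : z ^ (a - 1 - 1) = z⁻¹ * z ^ (a - 1) := by
      rw [show a - 1 - 1 = -1 + (a - 1) by ring, Real.rpow_add hz', Real.rpow_neg_one]
    have hlog : |Real.log z| ≤ z + z⁻¹ := by
      have l1 := Real.log_le_sub_one_of_pos hz'
      have l2 := Real.log_le_sub_one_of_pos (inv_pos.2 hz')
      rw [Real.log_inv] at l2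
      have := inv_pos.2 hz'
      rw [abs_le]
      constructor <;> linarith
    rw [Real.norm_eq_abs, abs_mul, abs_of_nonneg hk]
    simp only [Pi.add_apply, hpow]
    nlinarith [mul_le_mul_of_nonneg_right hlog hk]

end GammaIntegrals

/-! ### The conditional Gamma law and the closed form of Q -/

section EStep

variable {V : Type*} [Fintype V] [DecidableEq V] {q : ℕ}

lemma mahalanobisSq_nonneg {θ : (V → ℝ) × Matrix V V ℝ} (hθ : θ.2.PosDef) (y : V → ℝ) :
    0 ≤ mahalanobisSq θ y := by
  have := hθ.posSemidef.dotProduct_mulVec_nonneg (y - θ.1)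
  rwa [star_trivial] at this

/-- The rate of the conditional Gamma distribution of the latent variable. -/
def postRate (ν : ℝ) (θ : (V → ℝ) × Matrix V V ℝ) (y : V → ℝ) : ℝ :=
  (ν + ν / (ν - 2) * mahalanobisSq θ y) / 2

/-- The factor of the joint density that does not depend on the latent variable. -/
def jointConst (ν : ℝ) (J : Matrix V V ℝ) : ℝ :=
  (ν / 2) ^ (ν / 2) / Real.Gamma (ν / 2) *
    Real.sqrt (ν ^ Fintype.card V * J.det / (2 * Real.pi * (ν - 2)) ^ Fintype.card V)

variable {ν : ℝ}

lemma postRate_pos (hν : 2 < ν) {θ : (V → ℝ) × Matrix V V ℝ} (hθ : θ.2.PosDef) (y : V → ℝ) :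
    0 < postRate ν θ y := by
  have h1 := mahalanobisSq_nonneg hθ y
  have h2 : 0 ≤ ν / (ν - 2) := div_nonneg (by linarith) (by linarith)
  have := mul_nonneg h2 h1
  unfold postRate
  linarith

lemma jointConst_pos (hν : 2 < ν) {J : Matrix V V ℝ} (hJ : J.PosDef) : 0 < jointConst ν J := by
  have h0 : 0 < ν / 2 := by linarith
  have h1 := Real.Gamma_pos_of_pos h0
  have h2 := hJ.det_pos
  have h3 : 0 < ν - 2 := by linarith
  have h4 : 0 < ν := by linarith
  have h5 := Real.pi_pos
  unfold jointConst
  positivity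

/-- Isolates the only dependence of the constant on J; the identity matrix serves as reference
point. -/
lemma log_jointConst (hν : 2 < ν) {J : Matrix V V ℝ} (hJ : J.PosDef) :
    Real.log (jointConst ν J) =
      Real.log (jointConst ν (1 : Matrix V V ℝ)) + 1 / 2 * Real.log J.det := by
  have h0 : 0 < ν / 2 := by linarith
  have h1 := Real.Gamma_pos_of_pos h0
  have h2 := hJ.det_pos
  have h3 : 0 < ν - 2 := by linarith
  have h4 : 0 < ν := by linarith
  have h5 := Real.pi_pos
  have h6 : jointConst ν J = jointConst ν (1 : Matrix V V ℝ) * Real.sqrt J.det := by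
    have h7 : ν ^ Fintype.card V * J.det / (2 * Real.pi * (ν - 2)) ^ Fintype.card V =
        ν ^ Fintype.card V * 1 / (2 * Real.pi * (ν - 2)) ^ Fintype.card V * J.det := by ring
    rw [jointConst, jointConst, det_one, h7, Real.sqrt_mul (by positivity)]
    ring
  rw [h6, Real.log_mul (jointConst_pos hν PosDef.one).ne' (Real.sqrt_pos.2 h2).ne',
    Real.log_sqrt h2.le]
  ring

/-- Conjugacy: the normal factor contributes p/2 to the Gamma exponent and the scaled quadratic form
to the rate, so in z the joint density is again a Gamma kernel. -/
lemma jointDensity_eq (θ : (V → ℝ) × Matrix V V ℝ) (y : V → ℝ) {z : ℝ} (hz : 0 < z) :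
    jointDensity ν θ y z = jointConst ν θ.2 *
      (z ^ ((ν + Fintype.card V) / 2 - 1) * Real.exp (-(postRate ν θ y * z))) := by
  have h1 : Real.sqrt (z ^ Fintype.card V * ν ^ Fintype.card V * θ.2.det /
      (2 * Real.pi * (ν - 2)) ^ Fintype.card V) = z ^ ((Fintype.card V : ℝ) / 2) *
      Real.sqrt (ν ^ Fintype.card V * θ.2.det / (2 * Real.pi * (ν - 2)) ^ Fintype.card V) := by
    rw [mul_assoc, mul_div_assoc, Real.sqrt_mul (by positivity), Real.sqrt_eq_rpow (z ^ _),
      ← Real.rpow_natCast, ← Real.rpow_mul hz.le]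
    congr 2
    ring
  have h2 : z ^ ((ν + Fintype.card V) / 2 - 1) =
      z ^ (ν / 2 - 1) * z ^ ((Fintype.card V : ℝ) / 2) := by
    rw [← Real.rpow_add hz]
    congr 1
    ring
  have h3 : Real.exp (-(postRate ν θ y * z)) = Real.exp (-(ν / 2 * z)) *
      Real.exp (-(z / 2 * (ν / (ν - 2)) * mahalanobisSq θ y)) := by
    rw [← Real.exp_add, postRate]
    congr 1
    ring
  rw [jointDensity, ProbabilityTheory.gammaPDFReal, if_pos hz.le, normalDensity, h1, h2, h3,
    jointConst]
  ring

lemma posterior_eq (hν : 2 < ν) {θ : (V → ℝ) × Matrix V V ℝ} (hθ : θ.2.PosDef) (y : V → ℝ)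
    {z : ℝ} (hz : 0 < z) :
    posterior ν θ y z = ((1 / postRate ν θ y) ^ ((ν + Fintype.card V) / 2) *
        Real.Gamma ((ν + Fintype.card V) / 2))⁻¹ *
      (z ^ ((ν + Fintype.card V) / 2 - 1) * Real.exp (-(postRate ν θ y * z))) := by
  have ha : 0 < (ν + Fintype.card V) / 2 := by positivity
  have h1 : ∫ u in Set.Ioi (0 : ℝ), jointDensity ν θ y u = jointConst ν θ.2 *
      ((1 / postRate ν θ y) ^ ((ν + Fintype.card V) / 2) *
        Real.Gamma ((ν + Fintype.card V) / 2)) := by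
    rw [← Real.integral_rpow_mul_exp_neg_mul_Ioi ha (postRate_pos hν hθ y), ← integral_const_mul]
    exact setIntegral_congr_fun measurableSet_Ioi fun u hu => jointDensity_eq θ y hu
  rw [posterior, h1, jointDensity_eq θ y hz, mul_div_mul_left _ _ (jointConst_pos hν hθ).ne',
    div_eq_inv_mul]

/-- The conditional mean of the latent variable is the Student weight. -/
theorem emWeight_eq (hν : 2 < ν) {θ : (V → ℝ) × Matrix V V ℝ} (hθ : θ.2.PosDef) (y : V → ℝ) :
    emWeight ν θ y = studentWeight ν θ y := by
  have ha : 0 < (ν + Fintype.card V) / 2 := by positivity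
  have hr := postRate_pos hν hθ y
  have hG := Real.Gamma_pos_of_pos ha
  have h1 : emWeight ν θ y = ∫ z in Set.Ioi (0 : ℝ),
      ((1 / postRate ν θ y) ^ ((ν + Fintype.card V) / 2) *
        Real.Gamma ((ν + Fintype.card V) / 2))⁻¹ *
      (z * (z ^ ((ν + Fintype.card V) / 2 - 1) * Real.exp (-(postRate ν θ y * z)))) := by
    refine setIntegral_congr_fun measurableSet_Ioi fun z hz => ?_
    simp only [posterior_eq hν hθ y hz]
    ring
  rw [h1, integral_const_mul, integral_mul_gammaKernel ha hr]
  have h2 : (1 / postRate ν θ y) ^ ((ν + Fintype.card V) / 2) *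
        Real.Gamma ((ν + Fintype.card V) / 2) ≠ 0 := by positivity
  rw [mul_left_comm, inv_mul_cancel₀ h2, mul_one, postRate, studentWeight,
    div_div_div_cancel_right₀ two_ne_zero]

/-- The part of `Q(η | θ)` that does not depend on `η`. -/
def emConst (ν : ℝ) (x : Fin q → V → ℝ) (θ : (V → ℝ) × Matrix V V ℝ) : ℝ :=
  ∑ s, (Real.log (jointConst ν (1 : Matrix V V ℝ)) + ((ν + Fintype.card V) / 2 - 1) *
    (∫ z in Set.Ioi (0 : ℝ), Real.log z * posterior ν θ (x s) z) -
      ν / 2 * studentWeight ν θ (x s))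

/-- The closed form of the E-step. -/
theorem emQ_eq (hν : 2 < ν) (x : Fin q → V → ℝ) {η θ : (V → ℝ) × Matrix V V ℝ}
    (hη : η.2.PosDef) (hθ : θ.2.PosDef) :
    emQ ν x η θ = emConst ν x θ + ((q : ℝ) / 2 * Real.log η.2.det -
      1 / 2 * (ν / (ν - 2)) * ∑ s, studentWeight ν θ (x s) * mahalanobisSq η (x s)) := by
  have hp : (0 : ℝ) ≤ Fintype.card V := Nat.cast_nonneg _
  have ha : 1 < (ν + Fintype.card V) / 2 := by linarith
  have ha0 : 0 < (ν + Fintype.card V) / 2 := by linarith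
  have hterm : ∀ y : V → ℝ, ∫ z in Set.Ioi (0 : ℝ), posterior ν θ y z *
      Real.log (jointDensity ν η y z) = Real.log (jointConst ν η.2) +
        ((ν + Fintype.card V) / 2 - 1) * (∫ z in Set.Ioi (0 : ℝ), Real.log z * posterior ν θ y z) -
        postRate ν η y * studentWeight ν θ y := by
    intro y
    have hr := postRate_pos hν hθ y
    have hc := jointConst_pos hν hη
    set K := ((1 / postRate ν θ y) ^ ((ν + Fintype.card V) / 2) *
        Real.Gamma ((ν + Fintype.card V) / 2))⁻¹ with hK
    have hpost : Set.EqOn (posterior ν θ y) (fun z => K *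
        (z ^ ((ν + Fintype.card V) / 2 - 1) * Real.exp (-(postRate ν θ y * z)))) (Set.Ioi 0) :=
      fun z hz => posterior_eq hν hθ y hz
    have hKne : (1 / postRate ν θ y) ^ ((ν + Fintype.card V) / 2) *
        Real.Gamma ((ν + Fintype.card V) / 2) ≠ 0 := by
      have := Real.Gamma_pos_of_pos (lt_trans one_pos ha)
      positivity
    have i1 : IntegrableOn (posterior ν θ y) (Set.Ioi 0) :=
      IntegrableOn.congr_fun ((integrableOn_gammaKernel ha0 hr).const_mul K)
        hpost.symm measurableSet_Ioi
    have i2 : IntegrableOn (fun z => z * posterior ν θ y z) (Set.Ioi 0) :=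
      IntegrableOn.congr_fun ((integrableOn_mul_gammaKernel ha0 hr).const_mul K)
        (fun z hz => by simp only [hpost hz]; ring) measurableSet_Ioi
    have i3 : IntegrableOn (fun z => Real.log z * posterior ν θ y z) (Set.Ioi 0) :=
      IntegrableOn.congr_fun ((integrableOn_log_mul_gammaKernel ha hr).const_mul K)
        (fun z hz => by simp only [hpost hz]; ring) measurableSet_Ioi
    have t1 : ∫ z in Set.Ioi (0 : ℝ), posterior ν θ y z = 1 := by
      rw [setIntegral_congr_fun measurableSet_Ioi hpost, integral_const_mul,
        Real.integral_rpow_mul_exp_neg_mul_Ioi (by linarith) hr, hK, inv_mul_cancel₀ hKne]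
    have t2 : ∫ z in Set.Ioi (0 : ℝ), z * posterior ν θ y z = studentWeight ν θ y :=
      emWeight_eq hν hθ y
    have hlog : Set.EqOn (fun z => posterior ν θ y z * Real.log (jointDensity ν η y z))
        (fun z => Real.log (jointConst ν η.2) * posterior ν θ y z +
          ((ν + Fintype.card V) / 2 - 1) * (Real.log z * posterior ν θ y z) -
          postRate ν η y * (z * posterior ν θ y z)) (Set.Ioi 0) := by
      intro z hz
      have hz' : (0 : ℝ) < z := hz
      have hpow := Real.rpow_pos_of_pos hz' ((ν + Fintype.card V) / 2 - 1)
      simp only [jointDensity_eq η y hz']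
      rw [Real.log_mul hc.ne' (mul_pos hpow (Real.exp_pos _)).ne',
        Real.log_mul hpow.ne' (Real.exp_pos _).ne', Real.log_exp, Real.log_rpow hz']
      ring
    rw [setIntegral_congr_fun measurableSet_Ioi hlog, integral_sub, integral_add,
      integral_const_mul, integral_const_mul, integral_const_mul, t1, t2, mul_one]
    · exact i1.const_mul _
    · exact i3.const_mul _
    · exact (i1.const_mul _).add (i3.const_mul _)
    · exact i2.const_mul _
  rw [emQ, emConst, Finset.mul_sum, Finset.sum_congr rfl fun s _ => hterm (x s)]
  have hq : (q : ℝ) / 2 * Real.log η.2.det = ∑ s : Fin q, 1 / 2 * Real.log η.2.det := by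
    rw [Finset.sum_const, Finset.card_univ, Fintype.card_fin, nsmul_eq_mul]; ring
  rw [hq, ← Finset.sum_sub_distrib, ← Finset.sum_add_distrib]
  refine Finset.sum_congr rfl fun s _ => ?_
  rw [log_jointConst hν hη, postRate]
  ring

end EStep

/-! ### Both M-steps as moment matching -/

section MStep

variable {V ι : Type*} [Fintype V] [DecidableEq V] [Fintype ι] {q : ℕ} {G : SimpleGraph V}
  {ν : ℝ} {x : Fin q → V → ℝ}

lemma studentWeight_pos (hν : 2 < ν) {θ : (V → ℝ) × Matrix V V ℝ} (hθ : θ.2.PosDef) (y : V → ℝ) :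
    0 < studentWeight ν θ y := by
  have h := postRate_pos hν hθ y
  unfold postRate at h
  have hp : (0 : ℝ) ≤ Fintype.card V := Nat.cast_nonneg _
  exact div_pos (by linarith) (by linarith)

lemma sum_studentWeight_pos (hν : 2 < ν) (hq : 0 < q) (x : Fin q → V → ℝ)
    {θ : (V → ℝ) × Matrix V V ℝ} (hθ : θ.2.PosDef) : 0 < ∑ s, studentWeight ν θ (x s) :=
  Finset.sum_pos (fun s _ => studentWeight_pos hν hθ (x s)) ⟨⟨0, hq⟩, Finset.mem_univ _⟩

lemma dotProduct_mulVec_comm {J : Matrix V V ℝ} (hJ : J.IsSymm) (u v : V → ℝ) :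
    u ⬝ᵥ (J *ᵥ v) = v ⬝ᵥ (J *ᵥ u) := by
  rw [dotProduct_mulVec, ← mulVec_transpose, hJ.eq, dotProduct_comm]

lemma posDef_isSymm {J : Matrix V V ℝ} (hJ : J.PosDef) : J.IsSymm := by
  have := hJ.isHermitian.eq
  rwa [conjTranspose_eq_transpose_of_trivial] at this

lemma dotProduct_mulVec_eq_zero {J : Matrix V V ℝ} (hJ : J.PosDef) {u : V → ℝ}
    (h : u ⬝ᵥ (J *ᵥ u) ≤ 0) : u = 0 := by
  by_contra hu
  have := hJ.dotProduct_mulVec_pos hu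
  rw [star_trivial] at this
  linarith

lemma weightedMean_eq_iff {w : Fin q → ℝ} (hw : 0 < ∑ s, w s) (x : Fin q → V → ℝ) (m : V → ℝ) :
    m = weightedMean w x ↔ ∑ s, w s • (x s - m) = 0 := by
  simp only [smul_sub, Finset.sum_sub_distrib, ← Finset.sum_smul]
  rw [sub_eq_zero, weightedMean]
  constructor
  · rintro rfl
    rw [smul_smul, mul_inv_cancel₀ hw.ne', one_smul]
  · intro h
    rw [h, smul_smul, inv_mul_cancel₀ hw.ne', one_smul]

lemma mahalanobisSq_shift {J : Matrix V V ℝ} (hJ : J.IsSymm) (a m y : V → ℝ) :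
    mahalanobisSq (a, J) y =
      mahalanobisSq (m, J) y + 2 * ((m - a) ⬝ᵥ (J *ᵥ (y - m))) + mahalanobisSq (a, J) m := by
  have h : y - a = (y - m) + (m - a) := by abel
  simp only [mahalanobisSq]
  rw [h, mulVec_add, dotProduct_add, add_dotProduct, add_dotProduct,
    dotProduct_mulVec_comm hJ (y - m) (m - a)]
  ring

/-- The parallel axis identity: the cross term vanishes because the weighted residuals around m sum
to zero. -/
lemma sum_mul_mahalanobisSq {J : Matrix V V ℝ} (hJ : J.IsSymm) {w : Fin q → ℝ}
    {m : V → ℝ} (hm : ∑ s, w s • (x s - m) = 0) (a : V → ℝ) :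
    ∑ s, w s * mahalanobisSq (a, J) (x s) =
      ∑ s, w s * mahalanobisSq (m, J) (x s) + (∑ s, w s) * mahalanobisSq (a, J) m := by
  have h1 : ∑ s, w s * ((m - a) ⬝ᵥ (J *ᵥ (x s - m))) = 0 := by
    calc ∑ s, w s * ((m - a) ⬝ᵥ (J *ᵥ (x s - m)))
        = (m - a) ⬝ᵥ (J *ᵥ ∑ s, w s • (x s - m)) := by
          rw [mulVec_sum, dotProduct_sum]
          simp only [mulVec_smul, dotProduct_smul, smul_eq_mul]
      _ = 0 := by rw [hm]; simp
  calc ∑ s, w s * mahalanobisSq (a, J) (x s)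
      = ∑ s, (w s * mahalanobisSq (m, J) (x s) + 2 * (w s * ((m - a) ⬝ᵥ (J *ᵥ (x s - m)))) +
          w s * mahalanobisSq (a, J) m) := by
        refine Finset.sum_congr rfl fun s _ => ?_
        rw [mahalanobisSq_shift hJ a m]; ring
    _ = _ := by
        rw [Finset.sum_add_distrib, Finset.sum_add_distrib, ← Finset.mul_sum, h1,
          ← Finset.sum_mul]
        ring

lemma emCov_isSymm (ν : ℝ) (x : Fin q → V → ℝ) (θ : (V → ℝ) × Matrix V V ℝ) (m : V → ℝ) :
    (emCov ν x θ m).IsSymm := by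
  ext i j
  simp only [emCov, weightedCov, transpose_apply, Matrix.smul_apply]
  congr 2
  exact Finset.sum_congr rfl fun s _ => by ring

lemma trace_emCov_mul (ν : ℝ) (x : Fin q → V → ℝ) (θ : (V → ℝ) × Matrix V V ℝ) (m : V → ℝ)
    (H : Matrix V V ℝ) :
    (emCov ν x θ m * H).trace =
      ν / (ν - 2) * (1 / (q : ℝ) * ∑ s, studentWeight ν θ (x s) * mahalanobisSq (m, H) (x s)) := by
  rw [emCov, Matrix.smul_mul, trace_smul, smul_eq_mul]
  congr 1
  simp only [trace, diag_apply, mul_apply, weightedCov, mahalanobisSq, dotProduct, mulVec,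
    Finset.mul_sum, Finset.sum_mul, Pi.sub_apply]
  rw [Finset.sum_comm]
  conv_rhs => rw [Finset.sum_comm]
  refine Finset.sum_congr rfl fun i _ => ?_
  rw [Finset.sum_comm]
  conv_rhs => rw [Finset.sum_comm]
  rw [Finset.sum_comm]
  refine Finset.sum_congr rfl fun s _ => Finset.sum_congr rfl fun j _ => ?_
  ring

lemma emQ_eq_gaussObj (hν : 2 < ν) (hq : 0 < q) (x : Fin q → V → ℝ)
    {η θ : (V → ℝ) × Matrix V V ℝ} (hη : η.2.PosDef) (hθ : θ.2.PosDef) :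
    emQ ν x η θ = emConst ν x θ + (q : ℝ) / 2 * gaussObj (emCov ν x θ η.1) η.2 := by
  have hq' : (q : ℝ) ≠ 0 := Nat.cast_ne_zero.2 hq.ne'
  rw [emQ_eq hν x hη hθ, gaussObj, trace_emCov_mul]
  field_simp

/-- As a function of the location, Q is a concave parabola whose vertex is the weighted mean for
every J. This is why the joint M-step decouples and why the two kinds of update share the new
location. -/
lemma emQ_eq_sub (hν : 2 < ν) (hq : 0 < q) (x : Fin q → V → ℝ) {θ : (V → ℝ) × Matrix V V ℝ}
    {J : Matrix V V ℝ} (hJ : J.PosDef) (hθ : θ.2.PosDef) (a : V → ℝ) :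
    emQ ν x (a, J) θ = emQ ν x (weightedMean (fun s => studentWeight ν θ (x s)) x, J) θ -
      1 / 2 * (ν / (ν - 2)) * ((∑ s, studentWeight ν θ (x s)) *
        mahalanobisSq (a, J) (weightedMean (fun s => studentWeight ν θ (x s)) x)) := by
  have hm := (weightedMean_eq_iff (sum_studentWeight_pos hν hq x hθ) x _).1 rfl
  rw [emQ_eq hν x (η := (a, J)) hJ hθ, emQ_eq hν x
    (η := (weightedMean (fun s => studentWeight ν θ (x s)) x, J)) hJ hθ,
    sum_mul_mahalanobisSq (posDef_isSymm hJ) hm a]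
  ring

lemma emQ_le_weightedMean (hν : 2 < ν) (hq : 0 < q) (x : Fin q → V → ℝ)
    {θ : (V → ℝ) × Matrix V V ℝ} {J : Matrix V V ℝ} (hJ : J.PosDef) (hθ : θ.2.PosDef)
    (a : V → ℝ) :
    emQ ν x (a, J) θ ≤ emQ ν x (weightedMean (fun s => studentWeight ν θ (x s)) x, J) θ := by
  rw [emQ_eq_sub hν hq x hJ hθ a]
  have h1 := sum_studentWeight_pos hν hq x hθ
  have h2 := mahalanobisSq_nonneg (θ := (a, J)) hJ
    (weightedMean (fun s => studentWeight ν θ (x s)) x)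
  have h3 : 0 ≤ ν / (ν - 2) := div_nonneg (by linarith) (by linarith)
  have := mul_nonneg (mul_nonneg (one_half_pos (α := ℝ)).le h3) (mul_nonneg h1.le h2)
  linarith

lemma eq_weightedMean_of_emQ_le (hν : 2 < ν) (hq : 0 < q) (x : Fin q → V → ℝ)
    {θ : (V → ℝ) × Matrix V V ℝ} {J : Matrix V V ℝ} (hJ : J.PosDef) (hθ : θ.2.PosDef)
    {a : V → ℝ}
    (h : emQ ν x (weightedMean (fun s => studentWeight ν θ (x s)) x, J) θ ≤ emQ ν x (a, J) θ) :
    a = weightedMean (fun s => studentWeight ν θ (x s)) x := by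
  rw [emQ_eq_sub hν hq x hJ hθ a] at h
  have h1 := sum_studentWeight_pos hν hq x hθ
  have h3 : 0 < ν / (ν - 2) := div_pos (by linarith) (by linarith)
  have h4 : 0 < 1 / 2 * (ν / (ν - 2)) := by linarith
  have h5 : mahalanobisSq (a, J) (weightedMean (fun s => studentWeight ν θ (x s)) x) ≤ 0 := by
    by_contra hc
    push Not at hc
    have := mul_pos h4 (mul_pos h1 hc)
    linarith
  exact (sub_eq_zero.1 (dotProduct_mulVec_eq_zero hJ h5)).symm

lemma emQ_le_iff (hν : 2 < ν) (hq : 0 < q) (x : Fin q → V → ℝ) {θ : (V → ℝ) × Matrix V V ℝ}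
    {J K : Matrix V V ℝ} (hJ : J.PosDef) (hK : K.PosDef) (hθ : θ.2.PosDef) (a : V → ℝ) :
    emQ ν x (a, K) θ ≤ emQ ν x (a, J) θ ↔
      gaussObj (emCov ν x θ a) K ≤ gaussObj (emCov ν x θ a) J := by
  have hq2 : (0 : ℝ) < q / 2 := by positivity
  rw [emQ_eq_gaussObj hν hq x (η := (a, K)) hK hθ, emQ_eq_gaussObj hν hq x (η := (a, J)) hJ hθ,
    add_le_add_iff_left, mul_le_mul_iff_right₀ hq2]

/-- The joint M-step is characterized by moment matching. -/
theorem isEMStep_iff (hν : 2 < ν) (hq : 0 < q) {θ θ' : (V → ℝ) × Matrix V V ℝ}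
    (hθ : θ ∈ params G) :
    IsEMStep G ν x θ θ' ↔ θ' ∈ params G ∧
      θ'.1 = weightedMean (fun s => studentWeight ν θ (x s)) x ∧
      AgreeOn G θ'.2⁻¹ (emCov ν x θ (weightedMean (fun s => studentWeight ν θ (x s)) x)) := by
  constructor
  · rintro ⟨h1, h2⟩
    have hm := eq_weightedMean_of_emQ_le hν hq x h1.1 hθ.1 (a := θ'.1) (h2 (_, θ'.2) h1)
    refine ⟨h1, hm, agreeOn_of_gaussObj_le (emCov_isSymm _ _ _ _) h1 fun K hK => ?_⟩
    rw [← emQ_le_iff hν hq x h1.1 hK.1 hθ.1, ← hm]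
    exact h2 (θ'.1, K) hK
  · rintro ⟨h1, hm, h2⟩
    refine ⟨h1, fun η hη => (emQ_le_weightedMean hν hq x hη.1 hθ.1 η.1).trans ?_⟩
    have : θ' = (weightedMean (fun s => studentWeight ν θ (x s)) x, θ'.2) := by rw [← hm]
    rw [this, emQ_le_iff hν hq x h1.1 hη.1 hθ.1]
    exact gaussObj_le_of_agreeOn h1 hη h2

/-- The separate M-step is characterized by moment matching. -/
theorem isSeparateEMStep_iff (hν : 2 < ν) (hq : 0 < q) {θ θ' : (V → ℝ) × Matrix V V ℝ}
    (hθ : θ ∈ params G) :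
    IsSeparateEMStep G ν x θ θ' ↔ θ' ∈ params G ∧
      θ'.1 = weightedMean (fun s => studentWeight ν θ (x s)) x ∧
      AgreeOn G θ'.2⁻¹ (emCov ν x θ θ.1) := by
  constructor
  · rintro ⟨h1, h2, h3⟩
    have hm := eq_weightedMean_of_emQ_le hν hq x h1.1 hθ.1 (a := θ'.1) (h2 _)
    refine ⟨h1, hm, agreeOn_of_gaussObj_le (emCov_isSymm _ _ _ _) h1 fun K hK => ?_⟩
    rw [← emQ_le_iff hν hq x h1.1 hK.1 hθ.1]
    exact h3 (θ.1, K) hK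
  · rintro ⟨h1, hm, h2⟩
    refine ⟨h1, fun m => ?_, fun η hη => ?_⟩
    · have : θ' = (weightedMean (fun s => studentWeight ν θ (x s)) x, θ'.2) := by rw [← hm]
      conv_rhs => rw [this]
      exact emQ_le_weightedMean hν hq x h1.1 hθ.1 m
    · rw [emQ_le_iff hν hq x h1.1 hη.1 hθ.1]
      exact gaussObj_le_of_agreeOn h1 hη h2

/-- The self-consistency conditions: the location is the weighted mean, and the inverse of `J`
matches the weighted covariance on the diagonal and on the edges. -/
def IsMomentMatched (G : SimpleGraph V) (ν : ℝ) (x : Fin q → V → ℝ)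
    (θ : (V → ℝ) × Matrix V V ℝ) : Prop :=
  θ.1 = weightedMean (fun s => studentWeight ν θ (x s)) x ∧ AgreeOn G θ.2⁻¹ (emCov ν x θ θ.1)

theorem isEMStep_self_iff (hν : 2 < ν) (hq : 0 < q) {θ : (V → ℝ) × Matrix V V ℝ}
    (hθ : θ ∈ params G) : IsEMStep G ν x θ θ ↔ IsMomentMatched G ν x θ := by
  rw [isEMStep_iff hν hq hθ, IsMomentMatched]
  constructor
  · rintro ⟨-, h1, h2⟩
    rw [← h1] at h2
    exact ⟨h1, h2⟩
  · rintro ⟨h1, h2⟩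
    rw [h1] at h2
    exact ⟨hθ, h1, h2⟩

theorem isSeparateEMStep_self_iff (hν : 2 < ν) (hq : 0 < q) {θ : (V → ℝ) × Matrix V V ℝ}
    (hθ : θ ∈ params G) : IsSeparateEMStep G ν x θ θ ↔ IsMomentMatched G ν x θ := by
  rw [isSeparateEMStep_iff hν hq hθ, IsMomentMatched]
  exact ⟨fun h => h.2, fun h => ⟨hθ, h⟩⟩

theorem solvesEquations_iff (F : CliqueForest G ι) {θ : (V → ℝ) × Matrix V V ℝ}
    (hθ : θ ∈ params G) : SolvesEquations F ν x θ ↔ IsMomentMatched G ν x θ := by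
  have hS := emCov_isSymm ν x θ θ.1
  constructor
  · intro h
    refine ⟨h.mean_eq, ?_⟩
    have hJ : θ.2 = cliqueMinusSep F (emCov ν x θ θ.1) := by
      ext i j
      by_cases hij : ∃ k, i ∈ F.C k ∧ j ∈ F.C k
      · exact h.entry_eq i j hij
      · rw [h.entry_zero i j hij, F.cliqueMinusSep_eq_zero _ hij]
    have h1 := F.agreeOn_cliqueMinusSep hS h.clique_posDef
    rwa [← hJ] at h1
  · rintro ⟨h1, h2⟩
    have hpd := F.block_posDef_of_agreeOn hθ h2
    have hJ := F.eq_cliqueMinusSep_of_agreeOn hS hθ h2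
    refine ⟨h1, hpd, fun e _ => F.sep_posDef hpd e, fun i j _ => congrFun (congrFun hJ i) j,
      fun i j hij => ?_⟩
    rw [hJ, F.cliqueMinusSep_eq_zero _ hij]

end MStep

/-! ### Stationary points and the minorization of the log-likelihood -/

section Stationary

variable {V : Type*} [Fintype V] [DecidableEq V] {q : ℕ} {G : SimpleGraph V}
  {ν : ℝ} {x : Fin q → V → ℝ}

lemma hasDerivAt_mahalanobisSq {θ : (V → ℝ) × Matrix V V ℝ} (hθ : θ.2.IsSymm) (h : V → ℝ)
    (H : Matrix V V ℝ) (y : V → ℝ) :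
    HasDerivAt (fun t : ℝ => mahalanobisSq (θ.1 + t • h, θ.2 + t • H) y)
      (mahalanobisSq (θ.1, H) y - 2 * (h ⬝ᵥ (θ.2 *ᵥ (y - θ.1)))) 0 := by
  set u := y - θ.1 with hu
  have h1 : (fun t : ℝ => mahalanobisSq (θ.1 + t • h, θ.2 + t • H) y) = fun t : ℝ =>
      u ⬝ᵥ (θ.2 *ᵥ u) + (u ⬝ᵥ (H *ᵥ u) - 2 * (h ⬝ᵥ (θ.2 *ᵥ u))) * t +
        (h ⬝ᵥ (θ.2 *ᵥ h) - h ⬝ᵥ (H *ᵥ u) - u ⬝ᵥ (H *ᵥ h) + h ⬝ᵥ (H *ᵥ h) * t) * t ^ 2 := by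
    funext t
    have : y - (θ.1 + t • h) = u - t • h := by rw [hu]; abel
    simp only [mahalanobisSq, this, mulVec_sub, add_mulVec, dotProduct_sub, sub_dotProduct,
      mulVec_smul, dotProduct_smul, smul_dotProduct, dotProduct_add, smul_mulVec, smul_eq_mul]
    rw [dotProduct_mulVec_comm hθ u h]
    ring
  rw [h1]
  have hid := hasDerivAt_id (0 : ℝ)
  have h2 := ((hid.const_mul (u ⬝ᵥ (H *ᵥ u) - 2 * (h ⬝ᵥ (θ.2 *ᵥ u)))).const_add
    (u ⬝ᵥ (θ.2 *ᵥ u))).add (((hid.const_mul (h ⬝ᵥ (H *ᵥ h))).const_add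
      (h ⬝ᵥ (θ.2 *ᵥ h) - h ⬝ᵥ (H *ᵥ u) - u ⬝ᵥ (H *ᵥ h))).mul (hid.pow 2))
  refine HasDerivAt.congr_deriv h2 ?_
  simp [mahalanobisSq, hu]

/-- Differentiating the logarithm of 1 + d²/(ν - 2) produces exactly the Student weights, so the
derivative of ℓ at θ is that of Q(· | θ) at θ. -/
lemma hasDerivAt_logLik (hν : 2 < ν) (hq : 0 < q) {θ : (V → ℝ) × Matrix V V ℝ}
    (hθ : θ.2.PosDef) (h : V → ℝ) (H : Matrix V V ℝ) :
    HasDerivAt (fun t : ℝ => logLik ν x (θ.1 + t • h, θ.2 + t • H))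
      ((q : ℝ) / 2 * ((θ.2⁻¹ * H).trace - (emCov ν x θ θ.1 * H).trace) +
        ν / (ν - 2) * (h ⬝ᵥ (θ.2 *ᵥ ∑ s, studentWeight ν θ (x s) • (x s - θ.1)))) 0 := by
  have hν2 : 0 < ν - 2 := by linarith
  have hq' : (q : ℝ) ≠ 0 := Nat.cast_ne_zero.2 hq.ne'
  have hpos : ∀ y, 0 < 1 + 1 / (ν - 2) * mahalanobisSq θ y := fun y => by
    have := mahalanobisSq_nonneg hθ y
    positivity
  have hs : ∀ s, HasDerivAt (fun t : ℝ => Real.log (1 + 1 / (ν - 2) *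
      mahalanobisSq (θ.1 + t • h, θ.2 + t • H) (x s)))
      (1 / (ν - 2) * (mahalanobisSq (θ.1, H) (x s) - 2 * (h ⬝ᵥ (θ.2 *ᵥ (x s - θ.1)))) /
        (1 + 1 / (ν - 2) * mahalanobisSq θ (x s))) 0 := by
    intro s
    have h1 := ((hasDerivAt_mahalanobisSq (posDef_isSymm hθ) h H (x s)).const_mul
      (1 / (ν - 2))).const_add 1
    have h2 := h1.log (by simpa using (hpos (x s)).ne')
    simpa using h2
  unfold logLik
  have hall := (((hasDerivAt_log_det hθ H).const_mul ((q : ℝ) / 2)).const_add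
    ((q : ℝ) * Real.log (Real.Gamma ((ν + Fintype.card V) / 2) /
      ((ν - 2) ^ ((Fintype.card V : ℝ) / 2) * Real.pi ^ ((Fintype.card V : ℝ) / 2)
        * Real.Gamma (ν / 2))))).sub
    ((HasDerivAt.fun_sum fun s (_ : s ∈ Finset.univ) => hs s).const_mul
      ((ν + Fintype.card V) / 2))
  refine HasDerivAt.congr_deriv hall ?_
  have hw : ∀ s, (ν + Fintype.card V) / 2 * (1 / (ν - 2) * (mahalanobisSq (θ.1, H) (x s) -
      2 * (h ⬝ᵥ (θ.2 *ᵥ (x s - θ.1)))) / (1 + 1 / (ν - 2) * mahalanobisSq θ (x s))) =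
      1 / 2 * (ν / (ν - 2)) * (studentWeight ν θ (x s) * mahalanobisSq (θ.1, H) (x s)) -
        ν / (ν - 2) * (studentWeight ν θ (x s) * (h ⬝ᵥ (θ.2 *ᵥ (x s - θ.1)))) := by
    intro s
    have h1 := hpos (x s)
    have h3 : 0 < ν := by linarith
    have h2 : ν + ν / (ν - 2) * mahalanobisSq θ (x s) =
        ν * (1 + 1 / (ν - 2) * mahalanobisSq θ (x s)) := by ring
    rw [studentWeight, h2]
    set D := 1 + 1 / (ν - 2) * mahalanobisSq θ (x s)
    field_simp
  rw [Finset.mul_sum, Finset.sum_congr rfl fun s _ => hw s, Finset.sum_sub_distrib,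
    ← Finset.mul_sum, ← Finset.mul_sum, trace_emCov_mul, mulVec_sum, dotProduct_sum]
  simp only [mulVec_smul, dotProduct_smul, smul_eq_mul]
  field_simp
  ring

theorem isStationary_iff (hν : 2 < ν) (hq : 0 < q) {θ : (V → ℝ) × Matrix V V ℝ}
    (hθ : θ ∈ params G) : IsStationary G ν x θ ↔ IsMomentMatched G ν x θ := by
  have hW := sum_studentWeight_pos hν hq x hθ.1
  have hν2 : 0 < ν / (ν - 2) := div_pos (by linarith) (by linarith)
  have hq' : (0 : ℝ) < q := Nat.cast_pos.2 hq
  rw [IsMomentMatched, weightedMean_eq_iff hW]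
  constructor
  · intro hst
    constructor
    · set g := ∑ s, studentWeight ν θ (x s) • (x s - θ.1) with hg
      -- The weighted residual sum g is itself used as the direction for the location; the
      -- derivative is then a positive multiple of g · J g.
      have h1 := (hasDerivAt_logLik (x := x) hν hq hθ.1 g 0).unique
        (hst g 0 (by simp [IsSymm]) (by simp))
      rw [← hg] at h1
      simp only [trace_zero, sub_zero, mul_zero, zero_add] at h1
      have h2 := (mul_eq_zero.1 h1).resolve_left hν2.ne'
      exact dotProduct_mulVec_eq_zero hθ.1 h2.le
    · refine agreeOn_of_trace_mul_eq (isSymm_inv hθ.1) (emCov_isSymm _ _ _ _) fun H hH hH0 => ?_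
      have h1 := (hasDerivAt_logLik (x := x) hν hq hθ.1 0 H).unique (hst 0 H hH hH0)
      simp only [zero_dotProduct, mul_zero, add_zero] at h1
      exact sub_eq_zero.1 ((mul_eq_zero.1 h1).resolve_left (by positivity))
  · rintro ⟨h1, h2⟩ h H hH hH0
    refine (hasDerivAt_logLik (x := x) hν hq hθ.1 h H).congr_deriv ?_
    rw [h1, trace_mul_eq_of_agreeOn h2 hH0]
    simp

/-- The basic inequality of the EM iteration: the log-likelihood increases at least as much as
`Q(· | θ)`. -/
theorem emQ_sub_le_logLik_sub (hν : 2 < ν) {θ η : (V → ℝ) × Matrix V V ℝ} (hθ : θ.2.PosDef)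
    (hη : η.2.PosDef) : emQ ν x η θ - emQ ν x θ θ ≤ logLik ν x η - logLik ν x θ := by
  have hν2 : 0 < ν - 2 := by linarith
  have hν0 : 0 < ν := by linarith
  have hs : ∀ s, (ν + Fintype.card V) / 2 * Real.log (1 + 1 / (ν - 2) * mahalanobisSq η (x s)) -
      (ν + Fintype.card V) / 2 * Real.log (1 + 1 / (ν - 2) * mahalanobisSq θ (x s)) ≤
      1 / 2 * (ν / (ν - 2)) * (studentWeight ν θ (x s) * mahalanobisSq η (x s)) -
        1 / 2 * (ν / (ν - 2)) * (studentWeight ν θ (x s) * mahalanobisSq θ (x s)) := by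
    intro s
    have a1 := mahalanobisSq_nonneg hθ (x s)
    have a2 := mahalanobisSq_nonneg hη (x s)
    have b1 : 0 < 1 + 1 / (ν - 2) * mahalanobisSq θ (x s) := by positivity
    have b2 : 0 < 1 + 1 / (ν - 2) * mahalanobisSq η (x s) := by positivity
    -- The tangent of log at the value for θ bounds each likelihood term directly, and its slope is
    -- the EM weight up to constants; no entropy inequality for the latent variable enters.
    have c := Real.log_le_sub_one_of_pos (div_pos b2 b1)
    rw [Real.log_div b2.ne' b1.ne'] at c
    have hp : 0 ≤ (ν + Fintype.card V) / 2 := by positivity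
    have d := mul_le_mul_of_nonneg_left c hp
    have h2 : ν + ν / (ν - 2) * mahalanobisSq θ (x s) =
        ν * (1 + 1 / (ν - 2) * mahalanobisSq θ (x s)) := by ring
    rw [← mul_sub]
    refine d.trans (le_of_eq ?_)
    rw [studentWeight, h2, div_sub_one b1.ne']
    have h3 : 1 + 1 / (ν - 2) * mahalanobisSq η (x s) -
        (1 + 1 / (ν - 2) * mahalanobisSq θ (x s)) =
        1 / (ν - 2) * (mahalanobisSq η (x s) - mahalanobisSq θ (x s)) := by ring
    rw [h3]
    set D := 1 + 1 / (ν - 2) * mahalanobisSq θ (x s)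
    field_simp
  have hsum := Finset.sum_le_sum fun s (_ : s ∈ Finset.univ) => hs s
  rw [Finset.sum_sub_distrib, Finset.sum_sub_distrib, ← Finset.mul_sum, ← Finset.mul_sum,
    ← Finset.mul_sum, ← Finset.mul_sum] at hsum
  rw [emQ_eq hν x hη hθ, emQ_eq hν x hθ hθ, logLik, logLik]
  linarith

/-- If no η improves ℓ over θ, the minorization shows that no η improves Q(· | θ) either. -/
lemma isEMStep_self_of_isMLSolution (hν : 2 < ν) {θ : (V → ℝ) × Matrix V V ℝ}
    (h : IsMLSolution G ν x θ) : IsEMStep G ν x θ θ :=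
  ⟨h.1, fun η hη => by
    have h1 := emQ_sub_le_logLik_sub (x := x) hν h.1.1 hη.1
    have h2 := h.2 η hη
    linarith⟩

end Stationary

/-! ### Positivity of weighted covariances -/

section SampleCov

variable {V : Type*} [Fintype V] [DecidableEq V] {q : ℕ} {ν : ℝ} {x : Fin q → V → ℝ}

lemma weightedCov_quadForm (w : Fin q → ℝ) (x : Fin q → V → ℝ) (a : V → ℝ) (c : Finset V)
    (v : c → ℝ) :
    v ⬝ᵥ (block (weightedCov w x a) c *ᵥ v) =
      1 / (q : ℝ) * ∑ s, w s * (∑ i : c, v i * (x s i - a i)) ^ 2 := by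
  simp only [dotProduct, mulVec, block, submatrix_apply, weightedCov, sq, Finset.sum_mul_sum]
  simp only [Finset.mul_sum, Finset.sum_mul]
  conv_rhs => rw [Finset.sum_comm]
  refine Finset.sum_congr rfl fun i _ => ?_
  conv_rhs => rw [Finset.sum_comm]
  refine Finset.sum_congr rfl fun j _ => Finset.sum_congr rfl fun s _ => ?_
  ring

/-- As the weights are positive, a null vector v of the weighted form satisfies v · (x(s) - a) = 0
for all s. Then v · x(s) is constant in s, and v is also null for the unweighted sample covariance,
whatever the centre a. -/
lemma block_emCov_posDef (hν : 2 < ν) (hq : 0 < q) {θ : (V → ℝ) × Matrix V V ℝ}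
    (hθ : θ.2.PosDef) {c : Finset V}
    (h : (block (weightedCov 1 x (weightedMean 1 x)) c).PosDef) (a : V → ℝ) :
    (block (emCov ν x θ a) c).PosDef := by
  have hν2 : 0 < ν / (ν - 2) := div_pos (by linarith) (by linarith)
  have hq' : (0 : ℝ) < q := Nat.cast_pos.2 hq
  have hb : block (emCov ν x θ a) c =
      (ν / (ν - 2)) • block (weightedCov (fun s => studentWeight ν θ (x s)) x a) c := rfl
  refine PosDef.of_dotProduct_mulVec_pos ?_ fun v hv => ?_
  · have : (block (emCov ν x θ a) c)ᵀ = block (emCov ν x θ a) c := by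
      rw [block, transpose_submatrix, (emCov_isSymm ν x θ a).eq]
    rwa [IsHermitian, conjTranspose_eq_transpose_of_trivial]
  · rw [star_trivial, hb, smul_mulVec, dotProduct_smul, weightedCov_quadForm, smul_eq_mul]
    refine mul_pos hν2 (mul_pos (by positivity) ?_)
    have hnn : ∀ s ∈ Finset.univ, 0 ≤ studentWeight ν θ (x s) *
        (∑ i : c, v i * (x s i - a i)) ^ 2 := fun s _ =>
      mul_nonneg (studentWeight_pos hν hθ (x s)).le (sq_nonneg _)
    refine lt_of_le_of_ne (Finset.sum_nonneg hnn) fun h0 => ?_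
    have h1 := (Finset.sum_eq_zero_iff_of_nonneg hnn).1 h0.symm
    have h2 : ∀ s, ∑ i : c, v i * (x s i - a i) = 0 := fun s => by
      have := (mul_eq_zero.1 (h1 s (Finset.mem_univ s))).resolve_left
        (studentWeight_pos hν hθ (x s)).ne'
      exact pow_eq_zero_iff two_ne_zero |>.1 this
    set m := weightedMean 1 x with hm
    have h3 : ∀ s, ∑ i : c, v i * (x s i - m i) = ∑ i : c, v i * (a i - m i) := fun s => by
      rw [← sub_zero (∑ i : c, v i * (x s i - m i)), ← h2 s, ← Finset.sum_sub_distrib]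
      exact Finset.sum_congr rfl fun i _ => by ring
    have h4 : ∑ s, (1 : Fin q → ℝ) s • (x s - m) = 0 :=
      (weightedMean_eq_iff (by simpa using hq') x m).1 hm
    have h5 : ∑ s, ∑ i : c, v i * (x s i - m i) = 0 := by
      rw [Finset.sum_comm]
      refine Finset.sum_eq_zero fun i _ => ?_
      have := congrFun h4 i
      simp only [Pi.one_apply, one_smul, Finset.sum_apply, Pi.sub_apply, Pi.zero_apply] at this
      rw [← Finset.mul_sum, this, mul_zero]
    simp only [h3, Finset.sum_const, Finset.card_univ, Fintype.card_fin, nsmul_eq_mul] at h5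
    have h6 := (mul_eq_zero.1 h5).resolve_left hq'.ne'
    have h7 := h.dotProduct_mulVec_pos hv
    rw [star_trivial, weightedCov_quadForm] at h7
    simp only [h3, h6] at h7
    simp at h7

end SampleCov

/-! ### Continuity of the EM quantities -/

section Limits

variable {V ι : Type*} [Fintype V] [DecidableEq V] [Fintype ι] {q : ℕ} {G : SimpleGraph V}
  {ν : ℝ} {x : Fin q → V → ℝ}

lemma continuous_mahalanobisSq (y : V → ℝ) :
    Continuous fun θ : (V → ℝ) × Matrix V V ℝ => mahalanobisSq θ y := by
  unfold mahalanobisSq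
  fun_prop

lemma continuousAt_studentWeight (hν : 2 < ν) {θ : (V → ℝ) × Matrix V V ℝ} (hθ : θ.2.PosDef)
    (y : V → ℝ) : ContinuousAt (fun η => studentWeight ν η y) θ := by
  unfold studentWeight
  refine continuousAt_const.div ?_ ?_
  · exact ((continuous_mahalanobisSq y).const_mul _ |>.const_add _).continuousAt
  · have := postRate_pos hν hθ y
    unfold postRate at this
    linarith

lemma continuousAt_weightedMean (hν : 2 < ν) (hq : 0 < q) {θ : (V → ℝ) × Matrix V V ℝ}
    (hθ : θ.2.PosDef) :
    ContinuousAt (fun η => weightedMean (fun s => studentWeight ν η (x s)) x) θ := by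
  have h1 : ∀ s, ContinuousAt (fun η => studentWeight ν η (x s)) θ := fun s =>
    continuousAt_studentWeight hν hθ (x s)
  have h2 : ContinuousAt (fun η => ∑ s, studentWeight ν η (x s)) θ :=
    tendsto_finsetSum _ fun s _ => h1 s
  have h3 : ContinuousAt (fun η => ∑ s, studentWeight ν η (x s) • x s) θ :=
    tendsto_finsetSum _ fun s _ => (h1 s).smul continuousAt_const
  exact (h2.inv₀ (sum_studentWeight_pos hν hq x hθ).ne').smul h3

lemma tendsto_emCov (hν : 2 < ν) {α : Type*} {l : Filter α} {θ : (V → ℝ) × Matrix V V ℝ}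
    (hθ : θ.2.PosDef) {f : α → (V → ℝ) × Matrix V V ℝ} {g : α → V → ℝ} {m : V → ℝ}
    (hf : Tendsto f l (𝓝 θ)) (hg : Tendsto g l (𝓝 m)) :
    Tendsto (fun t => emCov ν x (f t) (g t)) l (𝓝 (emCov ν x θ m)) := by
  unfold emCov
  refine Tendsto.const_smul ?_ _
  refine tendsto_pi_nhds.2 fun i => tendsto_pi_nhds.2 fun j => ?_
  unfold weightedCov
  refine Tendsto.const_mul _ (tendsto_finsetSum _ fun s _ => ?_)
  have hi := tendsto_pi_nhds.1 hg i
  have hj := tendsto_pi_nhds.1 hg j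
  exact ((continuousAt_studentWeight hν hθ (x s)).tendsto.comp hf).mul
    ((tendsto_const_nhds.sub hi).mul (tendsto_const_nhds.sub hj))

lemma continuousAt_logLik (hν : 2 < ν) {θ : (V → ℝ) × Matrix V V ℝ} (hθ : θ.2.PosDef) :
    ContinuousAt (logLik ν x) θ := by
  unfold logLik
  have hν2 : 0 < ν - 2 := by linarith
  refine ContinuousAt.sub (continuousAt_const.add (continuousAt_const.mul ?_))
    (continuousAt_const.mul (tendsto_finsetSum _ fun s _ => ?_))
  · exact ContinuousAt.log (continuous_snd.matrix_det.continuousAt) hθ.det_pos.ne'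
  · refine ContinuousAt.log ?_ ?_
    · exact ((continuous_mahalanobisSq (x s)).const_mul _ |>.const_add _).continuousAt
    · have := mahalanobisSq_nonneg hθ (x s)
      positivity

/-- Taking differences cancels `emConst`, so continuity of the conditional mean of log z is never
needed. -/
lemma tendsto_emQ_sub (hν : 2 < ν) (hq : 0 < q) {α : Type*} {l : Filter α}
    {θ η : (V → ℝ) × Matrix V V ℝ} {f g : α → (V → ℝ) × Matrix V V ℝ}
    (hθ : θ.2.PosDef) (hη : η.2.PosDef) (hfp : ∀ t, (f t).2.PosDef) (hgp : ∀ t, (g t).2.PosDef)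
    (hf : Tendsto f l (𝓝 θ)) (hg : Tendsto g l (𝓝 η)) :
    Tendsto (fun t => emQ ν x (g t) (f t) - emQ ν x (f t) (f t)) l
      (𝓝 (emQ ν x η θ - emQ ν x θ θ)) := by
  have key : ∀ {h : α → (V → ℝ) × Matrix V V ℝ} {ζ : (V → ℝ) × Matrix V V ℝ}, ζ.2.PosDef →
      Tendsto h l (𝓝 ζ) → Tendsto (fun t => gaussObj (emCov ν x (f t) (h t).1) (h t).2) l
        (𝓝 (gaussObj (emCov ν x θ ζ.1) ζ.2)) := by
    intro h ζ hζ hh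
    have h1 : Tendsto (fun t => (h t).1) l (𝓝 ζ.1) := (continuous_fst.tendsto ζ).comp hh
    have h2 : Tendsto (fun t => (h t).2) l (𝓝 ζ.2) := (continuous_snd.tendsto ζ).comp hh
    unfold gaussObj
    refine Tendsto.sub ?_ ?_
    · exact ((continuous_id.matrix_det.tendsto ζ.2).comp h2).log hζ.det_pos.ne'
    · have h3 := (tendsto_emCov (x := x) hν hθ hf h1).mul h2
      exact (continuous_id.matrix_trace.tendsto _).comp h3
  simp only [emQ_eq_gaussObj hν hq x (hgp _) (hfp _), emQ_eq_gaussObj hν hq x (hfp _) (hfp _),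
    emQ_eq_gaussObj hν hq x hη hθ, emQ_eq_gaussObj hν hq x hθ hθ, add_sub_add_left_eq_sub]
  exact ((key hη hg).const_mul _).sub ((key hθ hf).const_mul _)

end Limits

/-! ### Cluster points and convergence of EM sequences -/

section Sequence

variable {V ι : Type*} [Fintype V] [DecidableEq V] [Fintype ι] {q : ℕ} {G : SimpleGraph V}
  {ν : ℝ} {x : Fin q → V → ℝ} {θ : ℕ → (V → ℝ) × Matrix V V ℝ}

lemma IsEMSequence.mem_params (h : IsEMSequence G ν x θ) (t : ℕ) : θ t ∈ params G := by
  cases t with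
  | zero => exact h.1
  | succ t => exact (h.2 t).elim (fun h => h.1) fun h => h.1

lemma IsEMSequence.emQ_self_le (h : IsEMSequence G ν x θ) (t : ℕ) :
    emQ ν x (θ t) (θ t) ≤ emQ ν x (θ (t + 1)) (θ t) := by
  have hp := h.mem_params t
  rcases h.2 t with h1 | h1
  · exact h1.2 _ hp
  · exact (h1.2.2 _ hp).trans (h1.2.1 _)

lemma IsEMSequence.emQ_sub_le (hν : 2 < ν) (h : IsEMSequence G ν x θ) (t : ℕ) :
    emQ ν x (θ (t + 1)) (θ t) - emQ ν x (θ t) (θ t) ≤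
      logLik ν x (θ (t + 1)) - logLik ν x (θ t) :=
  emQ_sub_le_logLik_sub hν (h.mem_params t).1 (h.mem_params (t + 1)).1

lemma IsEMSequence.monotone_logLik (hν : 2 < ν) (h : IsEMSequence G ν x θ) :
    Monotone fun t => logLik ν x (θ t) :=
  monotone_nat_of_le_succ fun t => by
    have h1 := h.emQ_self_le t
    have h2 := h.emQ_sub_le hν t
    linarith

/-- Upgrades convergence of the likelihoods along an ultrafilter to convergence of the whole
sequence, so the likelihoods of the successors have the same limit. -/
lemma tendsto_atTop_of_monotone_of_le {f : ℕ → ℝ} (hf : Monotone f) {l : Filter ℕ} [l.NeBot]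
    (hl : l ≤ atTop) {a : ℝ} (h : Tendsto f l (𝓝 a)) : Tendsto f atTop (𝓝 a) := by
  refine tendsto_atTop_isLUB hf ⟨?_, fun b hb => ?_⟩
  · rintro _ ⟨t, rfl⟩
    exact ge_of_tendsto h ((eventually_ge_atTop t).filter_mono hl |>.mono fun s hs => hf hs)
  · exact le_of_tendsto h (Eventually.of_forall fun s => hb ⟨s, rfl⟩)

/-- Limits of an EM sequence along an ultrafilter are fixed points, and the EM map is continuous
there. -/
theorem IsEMSequence.ultrafilter_limit (F : CliqueForest G ι) (hν : 2 < ν) (hq : 0 < q)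
    (h : IsEMSequence G ν x θ) (U : Ultrafilter ℕ) (hU : (U : Filter ℕ) ≤ atTop)
    {θ' : (V → ℝ) × Matrix V V ℝ} (hθ' : θ' ∈ params G) (hlim : Tendsto θ U (𝓝 θ')) :
    IsMomentMatched G ν x θ' ∧ Tendsto (fun t => θ (t + 1)) U (𝓝 θ') := by
  have hp : ∀ t, (θ t).2.PosDef := fun t => (h.mem_params t).1
  have hL : Tendsto (fun t => logLik ν x (θ t)) atTop (𝓝 (logLik ν x θ')) :=
    tendsto_atTop_of_monotone_of_le (h.monotone_logLik hν) hU
      ((continuousAt_logLik hν hθ'.1).tendsto.comp hlim)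
  have hL1 : Tendsto (fun t => logLik ν x (θ (t + 1))) atTop (𝓝 (logLik ν x θ')) :=
    hL.comp (tendsto_add_atTop_nat 1)
  have hgap : Tendsto (fun t => logLik ν x (θ (t + 1)) - logLik ν x (θ t)) U (𝓝 0) := by
    have := (hL1.sub hL).mono_left hU
    rwa [sub_self] at this
  have hmean := (continuousAt_weightedMean (x := x) hν hq hθ'.1).tendsto.comp hlim
  have hfst : Tendsto (fun t => (θ t).1) U (𝓝 θ'.1) := (continuous_fst.tendsto θ').comp hlim
  -- An ultrafilter decides which kind of update occurs, so mixed runs need no separate treatment.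
  rcases U.eventually_or.1 (Eventually.of_forall (f := (U : Filter ℕ)) h.2) with hk | hk
  · have hfix : IsEMStep G ν x θ' θ' := by
      refine ⟨hθ', fun η hη => ?_⟩
      have h1 := tendsto_emQ_sub (x := x) hν hq hθ'.1 hη.1 hp (fun _ => hη.1) hlim
        (tendsto_const_nhds (x := η))
      -- The gain in Q of any competitor is at most that of the actual update, hence at most the
      -- likelihood gain, which tends to 0. Optimality of the limit comes from this without knowing
      -- that the successors converge.
      have h2 := le_of_tendsto_of_tendsto h1 hgap (hk.mono fun t ht =>
        (sub_le_sub_right (ht.2 η hη) _).trans (h.emQ_sub_le hν t))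
      linarith
    have hmm := (isEMStep_self_iff hν hq hθ').1 hfix
    refine ⟨hmm, ?_⟩
    have hm' := hmm.1
    have hpd := F.block_posDef_of_agreeOn hθ' hmm.2
    have hJ := F.eq_cliqueMinusSep_of_agreeOn (emCov_isSymm ν x θ' θ'.1) hθ' hmm.2
    rw [← hm'] at hmean
    have hlimJ := (F.continuousAt_cliqueMinusSep hpd).tendsto.comp
      (tendsto_emCov (x := x) hν hθ'.1 hlim hmean)
    rw [← hJ] at hlimJ
    -- The fixed point property has made the clique blocks at the limit positive definite, so the
    -- closed form of the update is continuous there and the successors converge.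
    refine (hmean.prodMk_nhds hlimJ).congr' (hk.mono fun t ht => ?_)
    obtain ⟨a1, a2, a3⟩ := (isEMStep_iff hν hq (h.mem_params t)).1 ht
    refine Prod.ext a2.symm ?_
    exact (F.eq_cliqueMinusSep_of_agreeOn (emCov_isSymm _ _ _ _) a1 a3).symm
  -- In the separate case only competitors with the location frozen at its current value can be
  -- compared at first, which gives optimality of the limiting J but not yet of the location.
  · have hag : AgreeOn G θ'.2⁻¹ (emCov ν x θ' θ'.1) := by
      refine agreeOn_of_gaussObj_le (emCov_isSymm _ _ _ _) hθ' fun K hK => ?_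
      rw [← emQ_le_iff hν hq x hθ'.1 hK.1 hθ'.1]
      have h1 := tendsto_emQ_sub (x := x) hν hq (η := (θ'.1, K)) (g := fun t => ((θ t).1, K))
        hθ'.1 hK.1 hp (fun _ => hK.1) hlim (hfst.prodMk_nhds tendsto_const_nhds)
      have h2 := le_of_tendsto_of_tendsto h1 hgap (hk.mono fun t ht =>
        (sub_le_sub_right ((ht.2.2 (0, K) hK).trans (ht.2.1 _)) _).trans (h.emQ_sub_le hν t))
      linarith
    have hpd := F.block_posDef_of_agreeOn hθ' hag
    have hJ := F.eq_cliqueMinusSep_of_agreeOn (emCov_isSymm ν x θ' θ'.1) hθ' hag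
    have hlimJ := (F.continuousAt_cliqueMinusSep hpd).tendsto.comp
      (tendsto_emCov (x := x) hν hθ'.1 hlim hfst)
    rw [← hJ] at hlimJ
    have hnext : Tendsto (fun t => θ (t + 1)) U
        (𝓝 (weightedMean (fun s => studentWeight ν θ' (x s)) x, θ'.2)) := by
      refine (hmean.prodMk_nhds hlimJ).congr' (hk.mono fun t ht => ?_)
      obtain ⟨a1, a2, a3⟩ := (isSeparateEMStep_iff hν hq (h.mem_params t)).1 ht
      refine Prod.ext a2.symm ?_
      exact (F.eq_cliqueMinusSep_of_agreeOn (emCov_isSymm _ _ _ _) a1 a3).symm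
    -- The successors tend to the limit with its location replaced by the weighted mean. Both points
    -- have the same likelihood, so by minorization Q gains nothing, and uniqueness of the best
    -- location makes them equal.
    have hEq := tendsto_nhds_unique
      ((continuousAt_logLik (x := x) hν
        (θ := (weightedMean (fun s => studentWeight ν θ' (x s)) x, θ'.2)) hθ'.1).tendsto.comp hnext)
      (hL1.mono_left hU)
    have hle := emQ_sub_le_logLik_sub (x := x) (θ := θ')
      (η := (weightedMean (fun s => studentWeight ν θ' (x s)) x, θ'.2)) hν hθ'.1 hθ'.1
    have hm' := eq_weightedMean_of_emQ_le hν hq x hθ'.1 hθ'.1 (a := θ'.1)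
      (by linarith)
    refine ⟨⟨hm', hag⟩, ?_⟩
    rwa [← hm'] at hnext

lemma frequently_and_not_succ {P : ℕ → Prop} (h1 : ∃ᶠ t in atTop, P t)
    (h2 : ∃ᶠ t in atTop, ¬ P t) : ∃ᶠ t in atTop, P t ∧ ¬ P (t + 1) := by
  intro h3
  obtain ⟨T, hT⟩ := eventually_atTop.1 h3
  obtain ⟨t, ht, hPt⟩ := frequently_atTop.1 h1 T
  obtain ⟨t', ht', hPt'⟩ := frequently_atTop.1 h2 t
  refine hPt' (Nat.le_induction hPt (fun n hn hPn => ?_) t' ht')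
  by_contra hc
  exact hT n (ht.trans hn) ⟨hPn, hc⟩

/-- A sequence in a compact set with finitely many limit points, at which the shifted sequence has
the same limits, converges. -/
lemma exists_tendsto_of_finite_limits {X : Type*} [TopologicalSpace X] [T3Space X] {u : ℕ → X}
    {K P : Set X} (hK : IsCompact K) (hu : ∀ t, u t ∈ K) (hP : P.Finite)
    (hstep : ∀ U : Ultrafilter ℕ, (U : Filter ℕ) ≤ atTop → ∀ a ∈ K, Tendsto u U (𝓝 a) →
      a ∈ P ∧ Tendsto (fun t => u (t + 1)) U (𝓝 a)) :
    ∃ a ∈ P, Tendsto u atTop (𝓝 a) := by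
  have hlim : ∀ U : Ultrafilter ℕ, ∃ a ∈ K, Tendsto u U (𝓝 a) := fun U =>
    isCompact_iff_ultrafilter_le_nhds.1 hK (U.map u)
      (tendsto_principal.2 (Eventually.of_forall hu))
  obtain ⟨a, haK, ha⟩ := hlim (Ultrafilter.of atTop)
  have hle := Ultrafilter.of_le (atTop : Filter ℕ)
  refine ⟨a, (hstep _ hle a haK ha).1, fun W hW => ?_⟩
  -- Finiteness isolates a from the other possible limits; N is then a closed neighbourhood of a,
  -- inside W, containing no other point of P.
  have hfin : (P \ {a})ᶜ ∈ 𝓝 a :=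
    (hP.subset Set.sdiff_subset).isClosed.isOpen_compl.mem_nhds (by simp)
  obtain ⟨N, hN, hNc, hNW⟩ := exists_mem_nhds_isClosed_subset (inter_mem hW hfin)
  by_contra hcon
  have hout : ∃ᶠ t in atTop, u t ∉ N := by
    intro h
    refine hcon (h.mono fun t ht => ?_)
    exact (hNW (not_not.1 ht)).1
  have hin : ∃ᶠ t in atTop, u t ∈ N :=
    (Eventually.frequently (ha.eventually hN)).filter_mono hle
  have hfr := frequently_and_not_succ hin hout
  -- The sequence visits N and leaves it infinitely often, so there are infinitely many exit times.
  -- A limit along them lies in the closed set N, hence is a, yet the successors, which also tend to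
  -- a, lie outside N.
  have hne : (atTop ⊓ 𝓟 {t | u t ∈ N ∧ u (t + 1) ∉ N} : Filter ℕ).NeBot :=
    frequently_mem_iff_neBot.1 hfr
  set U := Ultrafilter.of (atTop ⊓ 𝓟 {t | u t ∈ N ∧ u (t + 1) ∉ N} : Filter ℕ) with hUdef
  have hU := Ultrafilter.of_le (atTop ⊓ 𝓟 {t | u t ∈ N ∧ u (t + 1) ∉ N} : Filter ℕ)
  have hmem : ∀ᶠ t in (U : Filter ℕ), u t ∈ N ∧ u (t + 1) ∉ N :=
    le_principal_iff.1 (hU.trans inf_le_right)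
  obtain ⟨b, hbK, hb⟩ := hlim U
  obtain ⟨hbP, hb'⟩ := hstep U (hU.trans inf_le_left) b hbK hb
  have hbN : b ∈ N := hNc.mem_of_tendsto hb (hmem.mono fun t ht => ht.1)
  have hba : b = a := by
    by_contra hne'
    exact (hNW hbN).2 ⟨hbP, hne'⟩
  subst hba
  obtain ⟨t, ht1, ht2⟩ := ((hb'.eventually hN).and hmem).exists
  exact ht2.2 ht1

end Sequence

end SparseStudent

end

/-! ### The main theorem -/

open SparseStudent in
theorem mainTheorem2 {V ι : Type*} [Fintype V] [DecidableEq V] [Fintype ι]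
    (G : SimpleGraph V) (F : CliqueForest G ι) (ν : ℝ) (hν : 2 < ν)
    {q : ℕ} (hq : 0 < q) (x : Fin q → V → ℝ) :
    -- the maximum likelihood solution has the clique-minus-separator form, and is an EM fixed point
    (∀ θ, IsMLSolution G ν x θ →
      SolvesEquations F ν x θ ∧ IsEMStep G ν x θ θ ∧ IsSeparateEMStep G ν x θ θ) ∧
    -- the weights are the EM weights
    (∀ θ ∈ params G, ∀ y, emWeight ν θ y = studentWeight ν θ y) ∧
    -- the equations characterize the stationary points and the EM fixed points
    (∀ θ ∈ params G,
      (IsStationary G ν x θ ↔ SolvesEquations F ν x θ) ∧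
      (IsEMStep G ν x θ θ ↔ SolvesEquations F ν x θ) ∧
      (IsSeparateEMStep G ν x θ θ ↔ SolvesEquations F ν x θ)) ∧
    -- the EM updates exist, are unique and are explicit when the clique sample covariances
    -- are positive definite
    ((∀ k, (block (weightedCov 1 x (weightedMean 1 x)) (F.C k)).PosDef) →
      ∀ θ ∈ params G, ∀ m, m = weightedMean (fun s => studentWeight ν θ (x s)) x →
        (∀ θ', IsEMStep G ν x θ θ' ↔ θ' = (m, cliqueMinusSep F (emCov ν x θ m))) ∧
        (∀ θ', IsSeparateEMStep G ν x θ θ' ↔ θ' = (m, cliqueMinusSep F (emCov ν x θ θ.1)))) ∧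
    -- behaviour of the EM iteration
    (∀ θ : ℕ → (V → ℝ) × Matrix V V ℝ, IsEMSequence G ν x θ →
      Monotone (fun t => logLik ν x (θ t)) ∧
      (∀ θ' ∈ params G, MapClusterPt θ' Filter.atTop θ → SolvesEquations F ν x θ') ∧
      (∀ θ' ∈ params G, Filter.Tendsto θ Filter.atTop (nhds θ') →
        SolvesEquations F ν x θ' ∧
        ∀ s, Filter.Tendsto (fun t => emWeight ν (θ t) (x s)) Filter.atTop
          (nhds (studentWeight ν θ' (x s)))) ∧
      (∀ K ⊆ params G, IsCompact K → (∀ t, θ t ∈ K) →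
        {θ' ∈ K | SolvesEquations F ν x θ'}.Finite →
        ∃ θ' ∈ K, SolvesEquations F ν x θ' ∧ Filter.Tendsto θ Filter.atTop (nhds θ'))) := by
  refine ⟨fun θ hML => ?_, fun θ hθ y => emWeight_eq hν hθ.1 y, fun θ hθ => ?_, ?_, ?_⟩
  · have hE := isEMStep_self_of_isMLSolution hν hML
    have hmm := (isEMStep_self_iff hν hq hML.1).1 hE
    exact ⟨(solvesEquations_iff F hML.1).2 hmm, hE, (isSeparateEMStep_self_iff hν hq hML.1).2 hmm⟩
  · rw [solvesEquations_iff F hθ]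
    exact ⟨isStationary_iff hν hq hθ, isEMStep_self_iff hν hq hθ,
      isSeparateEMStep_self_iff hν hq hθ⟩
  · rintro hpd θ hθ m rfl
    have hblock : ∀ a k, (block (emCov ν x θ a) (F.C k)).PosDef := fun a k =>
      block_emCov_posDef hν hq hθ.1 (hpd k) a
    have key : ∀ (a : V → ℝ) (θ' : (V → ℝ) × Matrix V V ℝ), (θ' ∈ params G ∧
        θ'.1 = weightedMean (fun s => studentWeight ν θ (x s)) x ∧
        AgreeOn G θ'.2⁻¹ (emCov ν x θ a)) ↔
        θ' = (weightedMean (fun s => studentWeight ν θ (x s)) x,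
          cliqueMinusSep F (emCov ν x θ a)) := by
      intro a θ'
      have hS := emCov_isSymm ν x θ a
      constructor
      · rintro ⟨h1, h2, h3⟩
        exact Prod.ext h2 (F.eq_cliqueMinusSep_of_agreeOn hS h1 h3)
      · rintro rfl
        exact ⟨F.cliqueMinusSep_mem_precisions hS (hblock a), rfl,
          F.agreeOn_cliqueMinusSep hS (hblock a)⟩
    exact ⟨fun θ' => (isEMStep_iff hν hq hθ).trans (key _ θ'),
      fun θ' => (isSeparateEMStep_iff hν hq hθ).trans (key _ θ')⟩
  · intro θ hseq
    have hcl : ∀ θ' ∈ params G, MapClusterPt θ' Filter.atTop θ → SolvesEquations F ν x θ' := by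
      intro θ' hθ' hc
      obtain ⟨U, hU, hlim⟩ := mapClusterPt_iff_ultrafilter.1 hc
      exact (solvesEquations_iff F hθ').2 (hseq.ultrafilter_limit F hν hq U hU hθ' hlim).1
    refine ⟨hseq.monotone_logLik hν, hcl, fun θ' hθ' hlim => ⟨hcl θ' hθ' hlim.mapClusterPt,
      fun s => ?_⟩, fun K hKp hK hθK hfin => ?_⟩
    · have h1 := (continuousAt_studentWeight hν hθ'.1 (x s)).tendsto.comp hlim
      exact h1.congr fun t => (emWeight_eq hν (hseq.mem_params t).1 (x s)).symm
    -- Instance search does not unfold `Matrix` to the function space carrying the product topology,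
    -- so the separation property is transferred by hand.
    · have : T3Space (Matrix V V ℝ) := inferInstanceAs (T3Space (V → V → ℝ))
      obtain ⟨a, ha, hlim⟩ := exists_tendsto_of_finite_limits hK hθK hfin
        (fun U hU a haK hlim => by
          have h1 := hseq.ultrafilter_limit F hν hq U hU (hKp haK) hlim
          exact ⟨⟨haK, (solvesEquations_iff F (hKp haK)).2 h1.1⟩, h1.2⟩)
      exact ⟨a, ha.1, ha.2, hlim⟩
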